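/- Let $K\ge 2$, $p\in(0,1)$, $\varepsilon\in(0,1-p)$, and let $p_*^1,\dots,p_*^K$ be probability measures on $[0,1]^K$ such that under $p_*^i$ the $k$-th coordinate is $\mathrm{Bernoulli}(p+\varepsilon)$ if $k=i$ and $\mathrm{Bernoulli}(p)$ if $k\ne i$ (the dependence between coordinates is arbitrary). On a probability space let $p_*$ be uniformly distributed on $\{p_*^1,\dots,p_*^K\}$, and let $A_*\in\{1,\dots,K\}$ be a random action that almost surely maximizes the mean reward $a\mapsto\int r_a\,p_*(dr)$; put $R_*=\max_a\int r_a\,p_*(dr)$. Conditionally on $p_*$, the reward vectors $R_1,R_2,\dots$ are i.i.d. with law $p_*$ and independent of $A_*$. At each time $t\ge0$ an agent, having observed the history $H_t=(A_s,R_{s+1,A_s})_{0\le s<t}$, draws an action $A_t$ from a distribution that depends on $H_t$ only (so that, given $H_t$, the draw is independent of $p_*$, $A_*$ and the reward vectors). The agent is Thompson sampling: $\mathbb P_t(A_t=a)=\mathbb P_t(A_*=a)$ a.s. for all $t$ and $a$, where $\mathbb P_t=\mathbb P(\cdot\mid H_t)$ and $\mathbb E_t=\mathbb E[\cdot\mid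 H_t]$. Let $F(u)=\sum_{i:u_i>0}(u_i\log u_i-u_i)$ be the negentropy and $D_F(u,v)=F(u)-F(v)-\nabla_{u-v}F(v)$ its Bregman divergence, where $\nabla_{u-v}F(v)$ is the directional derivative of $F$ at $v$ in the direction $u-v$. Write $\pi(a)=\mathbb P_t(A_t=a)$, $\Delta_t=\sum_a\pi(a)\,\mathbb E_t[R_*-R_{t+1,a}]$, $g_t=\sum_a\pi(a)\,\mathbb E_t\big[D_F\big(\mathbb P_{t+1}(A_*\in\cdot),\mathbb P_t(A_*\in\cdot)\big)\mid A_t=a\big]$, $\Gamma_t=\Delta_t^2/g_t$ (the Shannon information ratio) and $q_t=\max_a\mathbb P_t(A_*=a)$. Then: 1. for every $t\ge1$, $\ \mathbb P\big(q_t>\tfrac12\big)\ge 1-\frac1\varepsilon\sqrt{\frac{8K}{t}}$; 2. for every $t\ge0$, almost surely $g_t>0$ and $\Gamma_t\le\dfrac{(1+q_t)^2}{2q_t^2}$; 3. for every $t\ge1$, $\ \mathbb P\big(\Gamma_t\le 8\big)\ge 1-\frac1\varepsilon\sqrt{\frac{8K}{t}}$; 4. for every $T\in\mathbb N$, $\ \mathrm{Regret}(T,\mathrm{TS}):=\mathbb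 E\Big[\sum_{t=0}^{T-1}(R_*-R_{t+1,A_t})\Big]\le 6\sqrt{2KT}$. -/

import Mathlib

open MeasureTheory ProbabilityTheory
open scoped unitInterval ENNReal

noncomputable section

/-- The set of probability measures on the cube `[0,1]^K` (the possible reward distributions). -/
abbrev RewardLaw (K : ℕ) : Type := ProbabilityMeasure (Fin K → I)

/-- The mean reward of action `a` under the reward distribution `P`. -/
def meanReward {K : ℕ} (P : RewardLaw K) (a : Fin K) : ℝ :=
  ∫ r, (r a : ℝ) ∂(P : Measure (Fin K → I))

/-- The history `H_t = (A_s, R_{s+1, A_s})_{0 ≤ s < t}`. -/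
def history {Ω : Type*} {K : ℕ} (A : ℕ → Ω → Fin K) (R : ℕ → Ω → Fin K → I) (t : ℕ) (ω : Ω) :
    Fin t → Fin K × I :=
  fun s => (A s ω, R (s + 1) ω (A s ω))

/-- The σ-algebra generated by the history `H_t`. -/
abbrev historySigma {Ω : Type*} {K : ℕ} (A : ℕ → Ω → Fin K) (R : ℕ → Ω → Fin K → I) (t : ℕ) :
    MeasurableSpace Ω :=
  MeasurableSpace.comap (history A R t) inferInstance

/-- A Bayesian `K`-armed bandit with rewards in `[0,1]`, together with an agent, on the
probability space `(Ω, μ)`. The reward vector `R t` is used for `t ≥ 1` only. -/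
structure BayesianBandit {Ω : Type*} [MeasurableSpace Ω] (K : ℕ) (μ : Measure Ω) where
  /-- the random reward distribution `p_*` -/
  pStar : Ω → RewardLaw K
  /-- the optimal action `A_*` -/
  AStar : Ω → Fin K
  /-- the reward vectors `R_1, R_2, …` -/
  R : ℕ → Ω → Fin K → I
  /-- the actions `A_0, A_1, …` of the agent -/
  A : ℕ → Ω → Fin K
  measurable_pStar : Measurable pStar
  measurable_AStar : Measurable AStar
  measurable_R : ∀ t, Measurable (R t)
  measurable_A : ∀ t, Measurable (A t)
  /-- `A_*` maximizes the mean reward under `p_*`. -/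
  optimal : ∀ᵐ ω ∂μ, ∀ a, meanReward (pStar ω) a ≤ meanReward (pStar ω) (AStar ω)
  /-- Conditioned on `p_*`, the reward vectors `R_1, R_2, …` are i.i.d. with distribution `p_*`. -/
  cond_iid : ∀ (S : Finset ℕ) (B : ℕ → Set (Fin K → I)), (∀ s, MeasurableSet (B s)) →
    μ⟦⋂ s ∈ S, R (s + 1) ⁻¹' B s | MeasurableSpace.comap pStar inferInstance⟧
      =ᵐ[μ] fun ω => ∏ s ∈ S, (pStar ω : Measure (Fin K → I)).real (B s)
  /-- Conditioned on `p_*`, the reward sequence is independent of `A_*`. -/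
  cond_indep_AStar : ∀ (a : Fin K) (S : Finset ℕ) (B : ℕ → Set (Fin K → I)),
    (∀ s, MeasurableSet (B s)) →
    μ⟦AStar ⁻¹' {a} ∩ ⋂ s ∈ S, R (s + 1) ⁻¹' B s | MeasurableSpace.comap pStar inferInstance⟧
      =ᵐ[μ] μ⟦AStar ⁻¹' {a} | MeasurableSpace.comap pStar inferInstance⟧ *
        μ⟦⋂ s ∈ S, R (s + 1) ⁻¹' B s | MeasurableSpace.comap pStar inferInstance⟧
  /-- The agent picks `A_t` from a distribution that is a function of the history `H_t` only:
  given `H_t`, the choice does not depend on `p_*`, `A_*` and the reward vectors. -/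
  policy : ∀ (t : ℕ) (a : Fin K),
    μ⟦A t ⁻¹' {a} | historySigma A R t ⊔ MeasurableSpace.comap pStar inferInstance ⊔
        MeasurableSpace.comap AStar inferInstance ⊔
        ⨆ s, MeasurableSpace.comap (R (s + 1)) inferInstance⟧
      =ᵐ[μ] μ⟦A t ⁻¹' {a} | historySigma A R t⟧

/-- The (generalized) Bregman divergence `D_F(u, v) = F(u) - F(v) - ∇_{u-v} F(v)`, where
`∇_{u-v} F(v)` is the one-sided directional derivative. -/
def bregman {K : ℕ} (F : (Fin K → ℝ) → ℝ) (u v : Fin K → ℝ) : ℝ :=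
  F u - F v - derivWithin (fun s : ℝ => F (v + s • (u - v))) (Set.Ici 0) 0

/-- The unnormalized negentropy potential. -/
def negentropy {K : ℕ} (u : Fin K → ℝ) : ℝ :=
  ∑ i, if 0 < u i then u i * Real.log (u i) - u i else 0

namespace BayesianBandit

variable {Ω : Type*} [MeasurableSpace Ω] {K : ℕ} {μ : Measure Ω}

/-- The σ-algebra generated by `H_t`. -/
abbrev hist (B : BayesianBandit K μ) (t : ℕ) : MeasurableSpace Ω := historySigma B.A B.R t

/-- The optimal mean reward `R_*`. -/
def RStar (B : BayesianBandit K μ) (ω : Ω) : ℝ := ⨆ a, meanReward (B.pStar ω) a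

/-- The Bayesian regret after `T` steps. -/
def regret (B : BayesianBandit K μ) (T : ℕ) : ℝ :=
  ∫ ω, ∑ t ∈ Finset.range T, (B.RStar ω - (B.R (t + 1) ω (B.A t ω) : ℝ)) ∂μ

/-- The posterior distribution `ℙ_t(A_* = a)` of the optimal action. -/
def posterior (B : BayesianBandit K μ) (t : ℕ) (ω : Ω) (a : Fin K) : ℝ :=
  (μ⟦B.AStar ⁻¹' {a} | B.hist t⟧) ω

/-- The probability `π(a) = ℙ_t(A_t = a)` with which the agent selects `a` at time `t`. -/
def actionProb (B : BayesianBandit K μ) (t : ℕ) (ω : Ω) (a : Fin K) : ℝ :=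
  (μ⟦B.A t ⁻¹' {a} | B.hist t⟧) ω

/-- The agent is Thompson sampling (probability matching). -/
def IsThompsonSampling (B : BayesianBandit K μ) : Prop :=
  ∀ (t : ℕ) (a : Fin K), ∀ᵐ ω ∂μ, B.actionProb t ω a = B.posterior t ω a

/-- `Δ_t(a) = 𝔼_t[R_* - R_{t+1,a}]`. -/
def expRegret (B : BayesianBandit K μ) (t : ℕ) (a : Fin K) : Ω → ℝ :=
  μ[fun ω => B.RStar ω - (B.R (t + 1) ω a : ℝ) | B.hist t]

/-- `g_t^F(a) = 𝔼_t[D_F(ℙ_{t+1}(A_* ∈ ·), ℙ_t(A_* ∈ ·)) | A_t = a]`, where the conditional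
expectation of `X` given the history and the event `A_t = a` is
`𝔼_t[X 1{A_t = a}] / ℙ_t(A_t = a)`. -/
def infoGain (B : BayesianBandit K μ) (F : (Fin K → ℝ) → ℝ) (t : ℕ) (a : Fin K) (ω : Ω) : ℝ :=
  (μ[(B.A t ⁻¹' {a}).indicator
      (fun ω' => bregman F (B.posterior (t + 1) ω') (B.posterior t ω')) | B.hist t]) ω /
    B.actionProb t ω a

/-- `Δ_t(π) = ∑_a π(a) Δ_t(a)` for the policy `π` of the agent. -/
def policyRegret (B : BayesianBandit K μ) (t : ℕ) (ω : Ω) : ℝ :=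
  ∑ a, B.actionProb t ω a * B.expRegret t a ω

/-- `g_t^F(π) = ∑_a π(a) g_t^F(a)` for the policy `π` of the agent. -/
def policyInfoGain (B : BayesianBandit K μ) (F : (Fin K → ℝ) → ℝ) (t : ℕ) (ω : Ω) : ℝ :=
  ∑ a, B.actionProb t ω a * B.infoGain F t a ω

/-- The information ratio `Γ_t^F(π) = Δ_t(π)² / g_t^F(π)`. -/
def infoRatio (B : BayesianBandit K μ) (F : (Fin K → ℝ) → ℝ) (t : ℕ) (ω : Ω) : ℝ :=
  (B.policyRegret t ω) ^ 2 / B.policyInfoGain F t ω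

/-- `q_t = max_a ℙ_t(A_* = a)`. -/
def maxPosterior (B : BayesianBandit K μ) (t : ℕ) (ω : Ω) : ℝ := ⨆ a, B.posterior t ω a

end BayesianBandit

/-- The reward distributions `p_*^1, …, p_*^K` of the example: under `p_*^i` the marginal of arm
`k` is Bernoulli with mean `p + ε` if `k = i` and `p` if `k ≠ i`. The dependence between the arms
is left arbitrary. -/
def HasHardMarginals {K : ℕ} (p ε : ℝ) (P : Fin K → RewardLaw K) : Prop :=
  ∀ i k : Fin K, ∃ q : I, (q : ℝ) = (if i = k then p + ε else p) ∧
    (P i : Measure (Fin K → I)).map (fun r => r k) = bernoulliMeasure 1 0 q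

/-- The prior `P_*`: probability `1/K` on each of `p_*^1, …, p_*^K`. -/
def uniformPrior {K : ℕ} (P : Fin K → RewardLaw K) : Measure (RewardLaw K) :=
  ∑ i, (K : ℝ≥0∞)⁻¹ • Measure.dirac (P i)

end

/-!
Everything takes place on the simplex of posteriors of the optimal arm. The event `A_* = i`
determines `p_*`, so `ℙ_t(A_* ∈ ·)` evolves by Bayes' rule with Bernoulli likelihoods, and at the
posterior `α` Thompson sampling has the expected regret `ε (1 - ∑ αₐ²)`.

For the information ratio, Pinsker's inequality bounds the negentropy information gain from below
by `2 ε² ∑ αₐ² (1 - αₐ)`; keeping only the term of the largest posterior probability in this sum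
and in `∑ αₐ²` gives the claimed bound.

For the regret, the potential is `2 ∑ √αₐ`: its expected decrease in one step is a weighted sum of
squared Hellinger distances, which dominates the squared regret divided by `√K`. Telescoping and
Cauchy–Schwarz give the regret bound `√(2KT)`. Since the posterior is a martingale, the expected
regret of one step is nonincreasing, hence it is at most `√(2K/t)` at time `t`. When no posterior
probability exceeds `1/2` the regret of the step is at least `ε/2`, so Markov's inequality shows
that this is unlikely.
-/

noncomputable section

section Inequalities

lemma add_mul_sub_le_of_convexOn {s : Set ℝ} {f : ℝ → ℝ} {f' x y : ℝ} (hf : ConvexOn ℝ s f)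
    (hx : x ∈ s) (hy : y ∈ s) (hf' : HasDerivAt f f' x) : f x + f' * (y - x) ≤ f y := by
  rcases lt_trichotomy x y with h | rfl | h
  · have := hf.le_slope_of_hasDerivAt hx hy h hf'
    rw [slope_def_field, le_div_iff₀ (sub_pos.2 h)] at this
    linarith
  · simp
  · have := hf.slope_le_of_hasDerivAt hy hx h hf'
    rw [slope_def_field, div_le_iff₀ (sub_pos.2 h)] at this
    linarith

lemma hasDerivAt_neg_binEntropy_sub_two_mul_sq {x : ℝ} (hx : x ∈ Set.Ioo 0 1) :
    HasDerivAt (fun x => -Real.binEntropy x - 2 * x ^ 2)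
      (-(Real.log (1 - x) - Real.log x) - 4 * x) x := by
  refine ((Real.hasDerivAt_binEntropy hx.1.ne' hx.2.ne).neg.sub
    (((hasDerivAt_id x).pow 2).const_mul 2)).congr_deriv ?_
  simp only [id, Nat.cast_ofNat]
  ring

lemma convexOn_neg_binEntropy_sub_two_mul_sq :
    ConvexOn ℝ (Set.Ioo 0 1) fun x => -Real.binEntropy x - 2 * x ^ 2 := by
  have hderiv2 : ∀ x ∈ Set.Ioo (0 : ℝ) 1,
      HasDerivAt (fun x => -(Real.log (1 - x) - Real.log x) - 4 * x)
        (1 / (x * (1 - x)) - 4) x := fun x hx => by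
    have hx0 : x ≠ 0 := hx.1.ne'
    have hx1 : 1 - x ≠ 0 := (sub_pos.2 hx.2).ne'
    refine (((((hasDerivAt_id x).const_sub 1).log hx1).sub (Real.hasDerivAt_log hx0)).neg.sub
      ((hasDerivAt_id x).const_mul 4)).congr_deriv ?_
    simp only [id]
    field_simp
    ring
  refine convexOn_of_hasDerivWithinAt2_nonneg (convex_Ioo 0 1)
    (fun x hx =>
      (hasDerivAt_neg_binEntropy_sub_two_mul_sq hx).continuousAt.continuousWithinAt)
    (fun x hx =>
      (hasDerivAt_neg_binEntropy_sub_two_mul_sq (interior_subset hx)).hasDerivWithinAt)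
    (fun x hx => (hderiv2 x (interior_subset hx)).hasDerivWithinAt) fun x hx => ?_
  obtain ⟨hx0, hx1⟩ := interior_subset hx
  rw [sub_nonneg, le_div_iff₀ (mul_pos hx0 (sub_pos.2 hx1))]
  nlinarith [sq_nonneg (2 * x - 1)]

-- The right-hand side minus the left-hand side is the Bregman divergence of
-- `-binEntropy x - 2 * x ^ 2`, so the inequality expresses the convexity of that function.
lemma two_mul_sq_sub_le_klDiv_bernoulli {x y : ℝ} (hx : x ∈ Set.Ioo 0 1)
    (hy : y ∈ Set.Ioo 0 1) :
    2 * (x - y) ^ 2 ≤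
      x * (Real.log x - Real.log y) + (1 - x) * (Real.log (1 - x) - Real.log (1 - y)) := by
  have htangent := add_mul_sub_le_of_convexOn convexOn_neg_binEntropy_sub_two_mul_sq hy hx
    (hasDerivAt_neg_binEntropy_sub_two_mul_sq hy)
  simp only [Real.binEntropy_eq_negMulLog_add_negMulLog_one_sub, Real.negMulLog] at htangent
  linarith

lemma sq_sub_le_sum_sq_sqrt_sub_sqrt {Y : Type*} {S : Finset Y} {f g : Y → ℝ}
    (hf : ∀ y ∈ S, 0 ≤ f y) (hg : ∀ y ∈ S, 0 ≤ g y) (hf1 : ∑ y ∈ S, f y = 1)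
    (hg1 : ∑ y ∈ S, g y = 1) {z : Y} (hz : z ∈ S) :
    (f z - g z) ^ 2 ≤ ∑ y ∈ S, (√(f y) - √(g y)) ^ 2 := by
  classical
  have hfactor : ∀ y ∈ S, |f y - g y| = |√(f y) - √(g y)| * (√(f y) + √(g y)) := fun y hy => by
    rw [← abs_of_nonneg (by positivity : 0 ≤ √(f y) + √(g y)), ← abs_mul]
    congr 1
    linear_combination Real.sq_sqrt (hg y hy) - Real.sq_sqrt (hf y hy)
  have htv : 2 * |f z - g z| ≤ ∑ y ∈ S, |f y - g y| := by
    have hrest : |f z - g z| ≤ ∑ y ∈ S.erase z, |f y - g y| := by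
      rw [← abs_neg]
      refine le_trans (le_of_eq (congrArg _ ?_)) (Finset.abs_sum_le_sum_abs _ _)
      rw [Finset.sum_erase_eq_sub hz, Finset.sum_sub_distrib, hf1, hg1]
      ring
    rw [← Finset.add_sum_erase S _ hz]
    linarith
  have hplus : ∑ y ∈ S, (√(f y) + √(g y)) ^ 2 ≤ 4 :=
    calc ∑ y ∈ S, (√(f y) + √(g y)) ^ 2 ≤ ∑ y ∈ S, 2 * (f y + g y) :=
          Finset.sum_le_sum fun y hy => by
            have := add_sq_le (a := √(f y)) (b := √(g y))
            rwa [Real.sq_sqrt (hf y hy), Real.sq_sqrt (hg y hy)] at this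
      _ = 4 := by rw [← Finset.mul_sum, Finset.sum_add_distrib, hf1, hg1]; norm_num
  have hcs := Finset.sum_mul_sq_le_sq_mul_sq S (fun y => |√(f y) - √(g y)|)
    fun y => √(f y) + √(g y)
  simp only [sq_abs] at hcs
  rw [← Finset.sum_congr rfl hfactor] at hcs
  have hnonneg : 0 ≤ ∑ y ∈ S, (√(f y) - √(g y)) ^ 2 := Finset.sum_nonneg fun _ _ => sq_nonneg _
  have hfour : (2 * |f z - g z|) ^ 2 ≤ (∑ y ∈ S, (√(f y) - √(g y)) ^ 2) * 4 :=
    (pow_le_pow_left₀ (by positivity) htv 2).trans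
      (hcs.trans (mul_le_mul_of_nonneg_left hplus hnonneg))
  rw [mul_pow, sq_abs] at hfour
  linarith

end Inequalities

section Negentropy

variable {K : ℕ} {u v : Fin K → ℝ}

lemma negentropy_of_pos (hu : ∀ i, 0 < u i) :
    negentropy u = ∑ i, (u i * Real.log (u i) - u i) := by
  simp [negentropy, hu]

lemma hasDerivAt_negentropy_lineMap (hv : ∀ i, 0 < v i) :
    HasDerivAt (fun s : ℝ => negentropy (v + s • (u - v)))
      (∑ i, (u i - v i) * Real.log (v i)) 0 := by
  have hpos : ∀ᶠ s : ℝ in nhds 0, ∀ i, 0 < v i + s * (u i - v i) :=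
    Filter.eventually_all.2 fun i => by
      have hcont : ContinuousAt (fun s : ℝ => v i + s * (u i - v i)) 0 := by fun_prop
      exact hcont.eventually (lt_mem_nhds (by simpa using hv i))
  have hformula : (fun s : ℝ => negentropy (v + s • (u - v))) =ᶠ[nhds 0] fun s =>
      ∑ i, ((v i + s * (u i - v i)) * Real.log (v i + s * (u i - v i)) -
        (v i + s * (u i - v i))) := by
    filter_upwards [hpos] with s hs
    simpa using negentropy_of_pos (u := v + s • (u - v)) (by simpa using hs)
  refine (HasDerivAt.fun_sum fun i _ => ?_).congr_of_eventuallyEq hformula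
  have hline : HasDerivAt (fun s : ℝ => v i + s * (u i - v i)) (u i - v i) 0 := by
    simpa using ((hasDerivAt_id (0 : ℝ)).mul_const (u i - v i)).const_add (v i)
  have hv0 := (hv i).ne'
  refine ((hline.fun_mul (hline.log (by simpa using hv0))).fun_sub hline).congr_deriv ?_
  simp only [zero_mul, add_zero]
  field_simp
  ring

lemma bregman_negentropy (hu : ∀ i, 0 < u i) (hv : ∀ i, 0 < v i) :
    bregman negentropy u v = ∑ i, (u i * (Real.log (u i) - Real.log (v i)) - u i + v i) := by
  rw [bregman, (hasDerivAt_negentropy_lineMap hv).hasDerivWithinAt.derivWithin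
    (uniqueDiffWithinAt_Ici 0), negentropy_of_pos hu, negentropy_of_pos hv,
    ← Finset.sum_sub_distrib, ← Finset.sum_sub_distrib]
  exact Finset.sum_congr rfl fun i _ => by ring

end Negentropy

section BayesUpdate

variable {ι Y : Type*} [Fintype ι] {L : ι → Y → ℝ} {α : ι → ℝ} {S : Finset Y}

/-- The probability of the observation `y` when the parameter `i` has the prior probability `α i`
and `L i` is the probability mass function of the observation under `i`. -/
def evidence (L : ι → Y → ℝ) (α : ι → ℝ) (y : Y) : ℝ := ∑ i, α i * L i y

/-- Bayes' rule: the posterior distribution of the parameter after the observation `y`. It is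
meaningful only if `evidence L α y ≠ 0`. -/
def bayesUpdate (L : ι → Y → ℝ) (α : ι → ℝ) (y : Y) (i : ι) : ℝ := α i * L i y / evidence L α y

/-- The `1/2`-Tsallis entropy `2 * ∑ i, √(α i) - 2`, without its additive constant. -/
def tsallis (α : ι → ℝ) : ℝ := 2 * ∑ i, √(α i)

/-- The expectation of `G a y` when the action `a` is drawn from `π` and the observation `y ∈ S` is
then drawn from the mixture, with weights `α`, of the distributions `L a i`. -/
def predictiveMean {A : Type*} [Fintype A] (S : Finset Y) (L : A → ι → Y → ℝ) (π : A → ℝ)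
    (α : ι → ℝ) (G : A → Y → ℝ) : ℝ :=
  ∑ a, π a * ∑ y ∈ S, evidence (L a) α y * G a y

lemma nonempty_of_sum_eq_one (hα1 : ∑ i, α i = 1) : Nonempty ι := by
  by_contra h
  simp [not_nonempty_iff.1 h] at hα1

lemma evidence_pos [Nonempty ι] (hα : ∀ i, 0 < α i) {y : Y} (hL : ∀ i, 0 < L i y) :
    0 < evidence L α y :=
  Finset.sum_pos (fun i _ => mul_pos (hα i) (hL i)) Finset.univ_nonempty

lemma sum_evidence (hα1 : ∑ i, α i = 1) (hL1 : ∀ i, ∑ y ∈ S, L i y = 1) :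
    ∑ y ∈ S, evidence L α y = 1 := by
  simp only [evidence]
  rw [Finset.sum_comm]
  simp [← Finset.mul_sum, hL1, hα1]

lemma bayesUpdate_pos [Nonempty ι] (hα : ∀ i, 0 < α i) {y : Y} (hL : ∀ i, 0 < L i y) (i : ι) :
    0 < bayesUpdate L α y i :=
  div_pos (mul_pos (hα i) (hL i)) (evidence_pos hα hL)

lemma evidence_mul_bayesUpdate {y : Y} (h : evidence L α y ≠ 0) (i : ι) :
    evidence L α y * bayesUpdate L α y i = α i * L i y :=
  mul_div_cancel₀ _ h

lemma sum_evidence_mul_bayesUpdate (h : ∀ y ∈ S, evidence L α y ≠ 0)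
    (hL1 : ∀ i, ∑ y ∈ S, L i y = 1) (i : ι) :
    ∑ y ∈ S, evidence L α y * bayesUpdate L α y i = α i := by
  rw [Finset.sum_congr rfl fun y hy => evidence_mul_bayesUpdate (h y hy) i, ← Finset.mul_sum,
    hL1, mul_one]

lemma sum_sq_le_sum_evidence_mul_sum_sq (hα : ∀ i, 0 < α i) (hα1 : ∑ i, α i = 1)
    (hL : ∀ i, ∀ y ∈ S, 0 < L i y) (hL1 : ∀ i, ∑ y ∈ S, L i y = 1) :
    ∑ i, α i ^ 2 ≤ ∑ y ∈ S, evidence L α y * ∑ i, bayesUpdate L α y i ^ 2 := by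
  have : Nonempty ι := nonempty_of_sum_eq_one hα1
  have hevidence : ∀ y ∈ S, 0 < evidence L α y := fun y hy => evidence_pos hα fun i => hL i y hy
  simp only [Finset.mul_sum]
  rw [Finset.sum_comm]
  refine Finset.sum_le_sum fun i _ => ?_
  rw [← sum_evidence_mul_bayesUpdate (fun y hy => (hevidence y hy).ne') hL1 i]
  exact Real.pow_arith_mean_le_arith_mean_pow_of_even S _ _ (fun y hy => (hevidence y hy).le)
    (sum_evidence hα1 hL1) even_two

lemma sum_sq_le_predictiveMean {A : Type*} [Fintype A] {L : A → ι → Y → ℝ} {π : A → ℝ}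
    (hπ : ∀ a, 0 ≤ π a) (hπ1 : ∑ a, π a = 1) (hα : ∀ i, 0 < α i) (hα1 : ∑ i, α i = 1)
    (hL : ∀ a i, ∀ y ∈ S, 0 < L a i y) (hL1 : ∀ a i, ∑ y ∈ S, L a i y = 1) :
    ∑ i, α i ^ 2 ≤ predictiveMean S L π α fun a y => ∑ i, bayesUpdate (L a) α y i ^ 2 := by
  rw [← one_mul (∑ i, α i ^ 2), ← hπ1, Finset.sum_mul]
  exact Finset.sum_le_sum fun a _ => mul_le_mul_of_nonneg_left
    (sum_sq_le_sum_evidence_mul_sum_sq hα hα1 (hL a) (hL1 a)) (hπ a)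

lemma predictiveMean_mul_one_sub {A : Type*} [Fintype A] {L : A → ι → Y → ℝ} {π : A → ℝ}
    (hπ1 : ∑ a, π a = 1) (hα1 : ∑ i, α i = 1) (hL1 : ∀ a i, ∑ y ∈ S, L a i y = 1) (c : ℝ)
    (G : A → Y → ℝ) :
    predictiveMean S L π α (fun a y => c * (1 - G a y)) = c * (1 - predictiveMean S L π α G) := by
  have hinner : ∀ a, ∑ y ∈ S, evidence (L a) α y * (c * (1 - G a y)) =
      c * (1 - ∑ y ∈ S, evidence (L a) α y * G a y) := fun a => by
    simp only [mul_left_comm _ c, ← Finset.mul_sum]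
    simp only [mul_one_sub, Finset.sum_sub_distrib, sum_evidence hα1 (hL1 a)]
  simp only [predictiveMean, hinner]
  simp only [mul_left_comm _ c, ← Finset.mul_sum]
  simp only [mul_one_sub, Finset.sum_sub_distrib, hπ1]

lemma evidence_mul_sqrt_bayesUpdate {y : Y} (hα : ∀ i, 0 ≤ α i) (hL : ∀ i, 0 ≤ L i y) (i : ι) :
    evidence L α y * √(bayesUpdate L α y i) = √(α i) * (√(L i y) * √(evidence L α y)) := by
  rw [bayesUpdate, Real.sqrt_div (mul_nonneg (hα i) (hL i)), Real.sqrt_mul (hα i),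
    mul_div_left_comm, Real.div_sqrt, mul_assoc]

lemma tsallis_sub_sum_evidence_mul_tsallis (hα : ∀ i, 0 ≤ α i) (hα1 : ∑ i, α i = 1)
    (hL : ∀ i, ∀ y ∈ S, 0 ≤ L i y) (hL1 : ∀ i, ∑ y ∈ S, L i y = 1) :
    tsallis α - ∑ y ∈ S, evidence L α y * tsallis (bayesUpdate L α y) =
      ∑ i, √(α i) * ∑ y ∈ S, (√(L i y) - √(evidence L α y)) ^ 2 := by
  have hevidence : ∀ y ∈ S, 0 ≤ evidence L α y := fun y hy =>
    Finset.sum_nonneg fun i _ => mul_nonneg (hα i) (hL i y hy)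
  have hhellinger : ∀ i, ∑ y ∈ S, (√(L i y) - √(evidence L α y)) ^ 2 =
      2 - 2 * ∑ y ∈ S, √(L i y) * √(evidence L α y) := fun i => by
    rw [Finset.sum_congr rfl fun y hy => show (√(L i y) - √(evidence L α y)) ^ 2 =
      L i y + evidence L α y - 2 * (√(L i y) * √(evidence L α y)) by
        linear_combination Real.sq_sqrt (hL i y hy) + Real.sq_sqrt (hevidence y hy),
      Finset.sum_sub_distrib, Finset.sum_add_distrib, hL1, sum_evidence hα1 hL1,
      ← Finset.mul_sum]
    norm_num
  have hupdate : ∑ y ∈ S, evidence L α y * tsallis (bayesUpdate L α y) =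
      2 * ∑ i, √(α i) * ∑ y ∈ S, √(L i y) * √(evidence L α y) := by
    simp only [Finset.mul_sum, tsallis]
    rw [Finset.sum_comm]
    refine Finset.sum_congr rfl fun i _ => Finset.sum_congr rfl fun y hy => ?_
    rw [mul_left_comm, evidence_mul_sqrt_bayesUpdate hα fun i => hL i y hy]
  rw [hupdate, tsallis, ← mul_sub, ← Finset.sum_sub_distrib, Finset.mul_sum]
  exact Finset.sum_congr rfl fun i _ => by rw [hhellinger]; ring

lemma sqrt_mul_sq_sub_evidence_le (hα : ∀ i, 0 ≤ α i) (hα1 : ∑ i, α i = 1)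
    (hL : ∀ i, ∀ y ∈ S, 0 ≤ L i y) (hL1 : ∀ i, ∑ y ∈ S, L i y = 1) {z : Y} (hz : z ∈ S) (i : ι) :
    √(α i) * (L i z - evidence L α z) ^ 2 ≤
      tsallis α - ∑ y ∈ S, evidence L α y * tsallis (bayesUpdate L α y) := by
  rw [tsallis_sub_sum_evidence_mul_tsallis hα hα1 hL hL1]
  refine (mul_le_mul_of_nonneg_left (sq_sub_le_sum_sq_sqrt_sub_sqrt (hL i)
    (fun y hy => Finset.sum_nonneg fun i _ => mul_nonneg (hα i) (hL i y hy)) (hL1 i)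
    (sum_evidence hα1 hL1) hz) (Real.sqrt_nonneg _)).trans ?_
  exact Finset.single_le_sum (f := fun i => √(α i) * ∑ y ∈ S, (√(L i y) - √(evidence L α y)) ^ 2)
    (fun j _ => mul_nonneg (Real.sqrt_nonneg _) (Finset.sum_nonneg fun _ _ => sq_nonneg _))
    (Finset.mem_univ i)

lemma sum_sqrt_le (hα : ∀ i, 0 ≤ α i) (hα1 : ∑ i, α i = 1) :
    ∑ i, √(α i) ≤ √(Fintype.card ι) := by
  refine Real.le_sqrt_of_sq_le ?_
  have := sq_sum_le_card_mul_sum_sq (s := Finset.univ) (f := fun i => √(α i))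
  simpa [Real.sq_sqrt (hα _), hα1] using this

lemma tsallis_le (hα : ∀ i, 0 ≤ α i) (hα1 : ∑ i, α i = 1) :
    tsallis α ≤ 2 * √(Fintype.card ι) :=
  mul_le_mul_of_nonneg_left (sum_sqrt_le hα hα1) zero_le_two

lemma tsallis_nonneg (α : ι → ℝ) : 0 ≤ tsallis α := by
  unfold tsallis
  positivity

end BayesUpdate

section BayesUpdateNegentropy

variable {K : ℕ} {Y : Type*} {L : Fin K → Y → ℝ} {α : Fin K → ℝ}

lemma evidence_mul_bregman_bayesUpdate [Nonempty (Fin K)] (hα : ∀ i, 0 < α i) {y : Y}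
    (hL : ∀ i, 0 < L i y) :
    evidence L α y * bregman negentropy (bayesUpdate L α y) α =
      ∑ i, α i * (L i y * (Real.log (L i y) - Real.log (evidence L α y)) - L i y +
        evidence L α y) := by
  have hevidence := evidence_pos hα hL
  rw [bregman_negentropy (bayesUpdate_pos hα hL) hα, Finset.mul_sum]
  refine Finset.sum_congr rfl fun i _ => ?_
  have hlog : Real.log (bayesUpdate L α y i) =
      Real.log (α i) + Real.log (L i y) - Real.log (evidence L α y) := by
    rw [bayesUpdate, Real.log_div (mul_pos (hα i) (hL i)).ne' hevidence.ne',
      Real.log_mul (hα i).ne' (hL i).ne']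
  rw [hlog]
  linear_combination (Real.log (L i y) - Real.log (evidence L α y) - 1) *
    evidence_mul_bayesUpdate hevidence.ne' i

lemma two_mul_sum_mul_sq_sub_evidence_le {y₀ y₁ : Y} (hα : ∀ i, 0 < α i) (hα1 : ∑ i, α i = 1)
    (hL₀ : ∀ i, 0 < L i y₀) (hL₁ : ∀ i, 0 < L i y₁) (hL : ∀ i, L i y₀ + L i y₁ = 1) :
    2 * ∑ i, α i * (L i y₁ - evidence L α y₁) ^ 2 ≤
      evidence L α y₀ * bregman negentropy (bayesUpdate L α y₀) α +
        evidence L α y₁ * bregman negentropy (bayesUpdate L α y₁) α := by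
  have : Nonempty (Fin K) := nonempty_of_sum_eq_one hα1
  have hevidence : evidence L α y₀ = 1 - evidence L α y₁ := by
    rw [eq_sub_iff_add_eq, evidence, evidence, ← Finset.sum_add_distrib, ← hα1]
    exact Finset.sum_congr rfl fun i _ => by rw [← mul_add, hL, mul_one]
  have hmem : evidence L α y₁ ∈ Set.Ioo (0 : ℝ) 1 :=
    ⟨evidence_pos hα hL₁, by linarith [evidence_pos hα hL₀]⟩
  rw [evidence_mul_bregman_bayesUpdate hα hL₀, evidence_mul_bregman_bayesUpdate hα hL₁,
    ← Finset.sum_add_distrib, Finset.mul_sum]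
  refine Finset.sum_le_sum fun i _ => ?_
  have hpinsker := two_mul_sq_sub_le_klDiv_bernoulli
    ⟨hL₁ i, by linarith [hL₀ i, hL i]⟩ hmem
  rw [hevidence, eq_sub_of_add_eq (hL i)]
  linarith [mul_le_mul_of_nonneg_left hpinsker (hα i).le]

end BayesUpdateNegentropy

/-- The probability that arm `a` yields the reward `y` under the reward distribution `P i`. -/
def armLikelihood {ι : Type*} {K : ℕ} (P : ι → RewardLaw K) (a : Fin K) (i : ι) (y : I) : ℝ :=
  (P i : Measure (Fin K → I)).real {r | r a = y}

/-- The mean reward of arm `a` under `p_*^i`. -/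
def hardMean {K : ℕ} (p ε : ℝ) (i a : Fin K) : ℝ := if i = a then p + ε else p

/-- The expected regret of one step of Thompson sampling in the example, when `α` is the posterior
distribution of the optimal arm. -/
def thompsonRegret {K : ℕ} (ε : ℝ) (α : Fin K → ℝ) : ℝ := ε * (1 - ∑ i, α i ^ 2)

section HardMarginals

variable {K : ℕ} {p ε : ℝ} {P : Fin K → RewardLaw K}

lemma hardMean_mem_Ioo (hp : p ∈ Set.Ioo 0 1) (hε : ε ∈ Set.Ioo 0 (1 - p)) (i a : Fin K) :
    hardMean p ε i a ∈ Set.Ioo 0 1 := by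
  have := hp.1
  have := hp.2
  have := hε.1
  have := hε.2
  unfold hardMean
  split_ifs <;> constructor <;> linarith

lemma hardMean_eq_iff (hε : ε ≠ 0) {i a : Fin K} : hardMean p ε i a = p + ε ↔ i = a := by
  unfold hardMean
  split_ifs with h <;> simp [h, hε]

lemma hardMean_le (hε : 0 ≤ ε) (i a : Fin K) : hardMean p ε i a ≤ p + ε := by
  unfold hardMean
  split_ifs <;> linarith

namespace HasHardMarginals

lemma meanReward_eq (hP : HasHardMarginals p ε P) (i a : Fin K) :
    meanReward (P i) a = hardMean p ε i a := by
  obtain ⟨q, hq, hmap⟩ := hP i a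
  have hmean : meanReward (P i) a =
      ∫ y : I, (y : ℝ) ∂(P i : Measure (Fin K → I)).map (fun r => r a) :=
    (integral_map (φ := fun r : Fin K → I => r a) (measurable_pi_apply a).aemeasurable
      measurable_subtype_coe.aestronglyMeasurable).symm
  rw [hmean, hmap, integral_bernoulliMeasure]
  simp [hq, hardMean]

lemma exists_armLikelihood_eq (hP : HasHardMarginals p ε P) (i a : Fin K) :
    ∃ q : I, (q : ℝ) = hardMean p ε i a ∧
      ∀ y, armLikelihood P a i y = (bernoulliMeasure 1 0 q).real {y} := by
  obtain ⟨q, hq, hmap⟩ := hP i a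
  refine ⟨q, hq, fun y => ?_⟩
  rw [← hmap, map_measureReal_apply (measurable_pi_apply a) (measurableSet_singleton y)]
  rfl

lemma armLikelihood_one (hP : HasHardMarginals p ε P) (i a : Fin K) :
    armLikelihood P a i 1 = hardMean p ε i a := by
  obtain ⟨q, hq, hy⟩ := hP.exists_armLikelihood_eq i a
  rw [hy, bernoulliMeasure_real_apply_of_mem_of_notMem _ (measurableSet_singleton _) (by simp)
    (by simp), hq]

lemma armLikelihood_zero (hP : HasHardMarginals p ε P) (i a : Fin K) :
    armLikelihood P a i 0 = 1 - hardMean p ε i a := by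
  obtain ⟨q, hq, hy⟩ := hP.exists_armLikelihood_eq i a
  rw [hy, bernoulliMeasure_real_apply_of_notMem_of_mem _ (measurableSet_singleton _) (by simp)
    (by simp)]
  simp [hq]

lemma ae_mem (hP : HasHardMarginals p ε P) (i a : Fin K) :
    ∀ᵐ r ∂(P i : Measure (Fin K → I)), r a ∈ ({0, 1} : Finset I) := by
  obtain ⟨q, -, hmap⟩ := hP i a
  refine ae_of_ae_map (f := fun r : Fin K → I => r a) (p := fun y => y ∈ ({0, 1} : Finset I))
    (measurable_pi_apply a).aemeasurable ?_
  rw [hmap, ae_iff]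
  exact bernoulliMeasure_apply_of_notMem_of_notMem _
    (Finset.measurableSet _).compl (by simp) (by simp)

lemma armLikelihood_pos (hP : HasHardMarginals p ε P) (hp : p ∈ Set.Ioo 0 1)
    (hε : ε ∈ Set.Ioo 0 (1 - p)) (a i : Fin K) {y : I} (hy : y ∈ ({0, 1} : Finset I)) :
    0 < armLikelihood P a i y := by
  have := hardMean_mem_Ioo hp hε i a
  simp only [Finset.mem_insert, Finset.mem_singleton] at hy
  rcases hy with rfl | rfl
  · rw [hP.armLikelihood_zero]
    exact sub_pos.2 this.2
  · rw [hP.armLikelihood_one]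
    exact this.1

lemma armLikelihood_zero_add_one (hP : HasHardMarginals p ε P) (a i : Fin K) :
    armLikelihood P a i 0 + armLikelihood P a i 1 = 1 := by
  rw [hP.armLikelihood_zero, hP.armLikelihood_one, sub_add_cancel]

lemma sum_armLikelihood (hP : HasHardMarginals p ε P) (a i : Fin K) :
    ∑ y ∈ ({0, 1} : Finset I), armLikelihood P a i y = 1 := by
  rw [Finset.sum_pair zero_ne_one, hP.armLikelihood_zero_add_one]

variable {α : Fin K → ℝ}

lemma evidence_one (hP : HasHardMarginals p ε P) (hα1 : ∑ i, α i = 1) (a : Fin K) :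
    evidence (armLikelihood P a) α 1 = p + ε * α a := by
  have hsplit : ∀ i, α i * hardMean p ε i a = α i * p + if i = a then α i * ε else 0 := fun i => by
    unfold hardMean
    split_ifs <;> ring
  simp only [evidence, hP.armLikelihood_one, hsplit, Finset.sum_add_distrib, ← Finset.sum_mul,
    hα1, Finset.sum_ite_eq', Finset.mem_univ, if_true]
  ring

end HasHardMarginals

variable {α : Fin K → ℝ}

lemma sum_mul_sq_hardMean_sub (hα1 : ∑ i, α i = 1) (a : Fin K) :
    ∑ i, α i * (hardMean p ε i a - (p + ε * α a)) ^ 2 = ε ^ 2 * (α a * (1 - α a)) := by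
  have hsplit : ∀ i, α i * (hardMean p ε i a - (p + ε * α a)) ^ 2 =
      α i * (ε * α a) ^ 2 + if i = a then α i * (ε ^ 2 * (1 - 2 * α a)) else 0 := fun i => by
    unfold hardMean
    split_ifs <;> ring
  simp only [hsplit, Finset.sum_add_distrib, ← Finset.sum_mul, hα1, Finset.sum_ite_eq',
    Finset.mem_univ, if_true]
  ring

lemma le_predictiveMean_bregman (hP : HasHardMarginals p ε P) (hp : p ∈ Set.Ioo 0 1)
    (hε : ε ∈ Set.Ioo 0 (1 - p)) (hα : ∀ i, 0 < α i) (hα1 : ∑ i, α i = 1) :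
    2 * ε ^ 2 * ∑ a, α a ^ 2 * (1 - α a) ≤
      predictiveMean {0, 1} (armLikelihood P) α α fun a y =>
        bregman negentropy (bayesUpdate (armLikelihood P a) α y) α := by
  rw [Finset.mul_sum]
  refine Finset.sum_le_sum fun a _ => ?_
  have hgain := two_mul_sum_mul_sq_sub_evidence_le (L := armLikelihood P a) (y₀ := 0) (y₁ := 1) hα
    hα1 (fun i => hP.armLikelihood_pos hp hε a i (by simp))
    (fun i => hP.armLikelihood_pos hp hε a i (by simp)) (hP.armLikelihood_zero_add_one a)
  simp only [hP.armLikelihood_one, hP.evidence_one hα1, sum_mul_sq_hardMean_sub hα1] at hgain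
  rw [Finset.sum_pair zero_ne_one, hP.evidence_one hα1]
  linarith [mul_le_mul_of_nonneg_left hgain (hα a).le]

lemma lt_one_of_sum_eq_one {ι : Type*} [Fintype ι] [Nontrivial ι] {α : ι → ℝ}
    (hα : ∀ i, 0 < α i) (hα1 : ∑ i, α i = 1) (a : ι) : α a < 1 := by
  obtain ⟨b, hb⟩ := exists_ne a
  rw [← hα1]
  exact Finset.single_lt_sum hb (Finset.mem_univ a) (Finset.mem_univ b) (hα b)
    fun i _ _ => (hα i).le

lemma sum_sq_le_one {ι : Type*} [Fintype ι] {α : ι → ℝ} (hα : ∀ i, 0 ≤ α i)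
    (hα1 : ∑ i, α i = 1) : ∑ i, α i ^ 2 ≤ 1 := by
  have := Finset.sum_sq_le_sq_sum_of_nonneg (s := Finset.univ) fun i _ => hα i
  rwa [hα1, one_pow] at this

lemma thompsonRegret_eq_sum (hα1 : ∑ i, α i = 1) :
    thompsonRegret ε α = ∑ i, α i * (ε * (1 - α i)) := by
  simp only [thompsonRegret, mul_left_comm _ ε, ← Finset.mul_sum]
  simp only [mul_one_sub, Finset.sum_sub_distrib, hα1, sq]

lemma thompsonRegret_nonneg (hε : 0 ≤ ε) (hα : ∀ i, 0 ≤ α i) (hα1 : ∑ i, α i = 1) :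
    0 ≤ thompsonRegret ε α :=
  mul_nonneg hε (sub_nonneg.2 (sum_sq_le_one hα hα1))

lemma half_le_thompsonRegret (hε : 0 ≤ ε) (hα : ∀ i, 0 ≤ α i) (hα1 : ∑ i, α i = 1)
    (hmax : ⨆ i, α i ≤ 1 / 2) : ε / 2 ≤ thompsonRegret ε α := by
  have hle : ∀ i, α i ≤ 1 / 2 := fun i =>
    (le_ciSup (Set.finite_range α).bddAbove i).trans hmax
  calc ε / 2 = ∑ i, α i * (ε * (1 - 1 / 2)) := by
        rw [← Finset.sum_mul, hα1]
        ring
    _ ≤ ∑ i, α i * (ε * (1 - α i)) := by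
        gcongr with i
        exacts [hα i, hle i]
    _ = thompsonRegret ε α := (thompsonRegret_eq_sum hα1).symm

lemma HasHardMarginals.predictiveMean_sub (hP : HasHardMarginals p ε P) (hα1 : ∑ i, α i = 1) :
    predictiveMean {0, 1} (armLikelihood P) α α (fun _ y => p + ε - y) = thompsonRegret ε α := by
  rw [thompsonRegret_eq_sum hα1, predictiveMean]
  refine Finset.sum_congr rfl fun a _ => congrArg (α a * ·) ?_
  have hsum := sum_evidence hα1 (hP.sum_armLikelihood a)
  rw [Finset.sum_pair zero_ne_one, hP.evidence_one hα1] at hsum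
  rw [Finset.sum_pair zero_ne_one, hP.evidence_one hα1, Set.Icc.coe_zero, Set.Icc.coe_one]
  linear_combination (p + ε) * hsum

lemma HasHardMarginals.predictiveMean_thompsonRegret_le (hP : HasHardMarginals p ε P)
    (hp : p ∈ Set.Ioo 0 1) (hε : ε ∈ Set.Ioo 0 (1 - p)) (hα : ∀ i, 0 < α i)
    (hα1 : ∑ i, α i = 1) :
    predictiveMean {0, 1} (armLikelihood P) α α
      (fun a y => thompsonRegret ε (bayesUpdate (armLikelihood P a) α y)) ≤
        thompsonRegret ε α := by
  simp only [thompsonRegret]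
  rw [predictiveMean_mul_one_sub hα1 hα1 hP.sum_armLikelihood]
  exact mul_le_mul_of_nonneg_left (sub_le_sub_left (sum_sq_le_predictiveMean (fun i => (hα i).le)
    hα1 hα hα1 (fun a i _ hy => hP.armLikelihood_pos hp hε a i hy) hP.sum_armLikelihood) 1)
    hε.1.le

lemma sq_thompsonRegret_div_le [Nontrivial (Fin K)] (hε : 0 < ε) (hα : ∀ i, 0 < α i)
    (hα1 : ∑ i, α i = 1) {g : ℝ} (hg : 2 * ε ^ 2 * ∑ a, α a ^ 2 * (1 - α a) ≤ g) :
    0 < g ∧ thompsonRegret ε α ^ 2 / g ≤ (1 + ⨆ a, α a) ^ 2 / (2 * (⨆ a, α a) ^ 2) := by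
  obtain ⟨b, hb⟩ := exists_eq_ciSup_of_finite (f := α)
  rw [← hb]
  have hlt := lt_one_of_sum_eq_one hα hα1
  have hb0 : 0 < α b := hα b
  have hb1 : 0 < 1 - α b := sub_pos.2 (hlt b)
  have hgain : 2 * ε ^ 2 * (α b ^ 2 * (1 - α b)) ≤ g :=
    (mul_le_mul_of_nonneg_left (Finset.single_le_sum (f := fun a => α a ^ 2 * (1 - α a))
      (fun i _ => mul_nonneg (sq_nonneg _) (sub_pos.2 (hlt i)).le) (Finset.mem_univ b))
      (by positivity)).trans hg
  have hgain0 : 0 < 2 * ε ^ 2 * (α b ^ 2 * (1 - α b)) := by positivity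
  have hregret0 : 0 ≤ thompsonRegret ε α :=
    thompsonRegret_nonneg hε.le (fun i => (hα i).le) hα1
  have hregret : thompsonRegret ε α ≤ ε * (1 - α b ^ 2) :=
    mul_le_mul_of_nonneg_left (sub_le_sub_left (Finset.single_le_sum (f := fun a => α a ^ 2)
      (fun i _ => sq_nonneg _) (Finset.mem_univ b)) 1) hε.le
  refine ⟨hgain0.trans_le hgain, ?_⟩
  calc thompsonRegret ε α ^ 2 / g
      ≤ (ε * (1 - α b ^ 2)) ^ 2 / (2 * ε ^ 2 * (α b ^ 2 * (1 - α b))) :=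
        div_le_div₀ (sq_nonneg _) (pow_le_pow_left₀ hregret0 hregret 2) hgain0 hgain
    _ = (1 + α b) ^ 2 * (1 - α b) / (2 * α b ^ 2) := by
        field_simp
        ring
    _ ≤ (1 + α b) ^ 2 / (2 * α b ^ 2) := by
        gcongr
        exact mul_le_of_le_one_right (sq_nonneg _) (by linarith)

lemma le_tsallis_sub_predictiveMean (hP : HasHardMarginals p ε P) (hp : p ∈ Set.Ioo 0 1)
    (hε : ε ∈ Set.Ioo 0 (1 - p)) (hα : ∀ i, 0 < α i) (hα1 : ∑ i, α i = 1) :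
    ∑ a, α a * (√(α a) * (ε * (1 - α a)) ^ 2) ≤
      tsallis α - predictiveMean {0, 1} (armLikelihood P) α α fun a y =>
        tsallis (bayesUpdate (armLikelihood P a) α y) := by
  have hweights : ∑ a, α a * tsallis α = tsallis α := by rw [← Finset.sum_mul, hα1, one_mul]
  rw [predictiveMean, ← hweights, ← Finset.sum_sub_distrib]
  simp only [← mul_sub]
  refine Finset.sum_le_sum fun a _ => mul_le_mul_of_nonneg_left ?_ (hα a).le
  have hdecrease := sqrt_mul_sq_sub_evidence_le (L := armLikelihood P a) (z := 1)
    (fun i => (hα i).le) hα1 (fun i y hy => (hP.armLikelihood_pos hp hε a i hy).le)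
    (hP.sum_armLikelihood a) (by simp) a
  rwa [hP.evidence_one hα1, hP.armLikelihood_one, hardMean, if_pos rfl,
    show p + ε - (p + ε * α a) = ε * (1 - α a) by ring] at hdecrease

lemma sq_thompsonRegret_le (hP : HasHardMarginals p ε P) (hp : p ∈ Set.Ioo 0 1)
    (hε : ε ∈ Set.Ioo 0 (1 - p)) (hα : ∀ i, 0 < α i) (hα1 : ∑ i, α i = 1) :
    thompsonRegret ε α ^ 2 ≤
      √K * (tsallis α - predictiveMean {0, 1} (armLikelihood P) α α fun a y =>
        tsallis (bayesUpdate (armLikelihood P a) α y)) := by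
  have hcs : (∑ i, α i * (ε * (1 - α i))) ^ 2 ≤
      (∑ i, √(α i)) * ∑ a, α a * (√(α a) * (ε * (1 - α a)) ^ 2) :=
    Finset.sum_sq_le_sum_mul_sum_of_sq_le_mul _ (fun i _ => Real.sqrt_nonneg _)
      (fun i _ => mul_nonneg (hα i).le (by positivity)) fun i _ => le_of_eq <| by
        linear_combination -(α i * ε ^ 2 * (1 - α i) ^ 2) * Real.mul_self_sqrt (hα i).le
  have hsqrt : ∑ i, √(α i) ≤ √K := by
    simpa using sum_sqrt_le (fun i => (hα i).le) hα1
  rw [thompsonRegret_eq_sum hα1]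
  exact hcs.trans (mul_le_mul hsqrt (le_tsallis_sub_predictiveMean hP hp hε hα hα1)
    (Finset.sum_nonneg fun i _ => mul_nonneg (hα i).le (by positivity)) (Real.sqrt_nonneg _))

end HardMarginals

section FiniteRange

variable {Ω X : Type*} [MeasurableSpace Ω] {μ : Measure Ω}

lemma real_cond {s : Set Ω} (hs : MeasurableSet s) (t : Set Ω) :
    μ[|s].real t = (μ.real s)⁻¹ * μ.real (s ∩ t) := by
  simp [Measure.real, cond_apply hs]

lemma measureReal_eq_sum_inter_preimage [IsFiniteMeasure μ] [Fintype X] [MeasurableSpace X]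
    [MeasurableSingletonClass X] {f : Ω → X} (hf : Measurable f) (s : Set Ω) :
    μ.real s = ∑ x, μ.real (f ⁻¹' {x} ∩ s) := by
  simp [← measureReal_restrict_apply (hf (measurableSet_singleton _)),
    sum_measureReal_preimage_singleton (μ := μ.restrict s) Finset.univ
      fun x _ => hf (measurableSet_singleton x)]

lemma ae_measure_preimage_ne_zero {f : Ω → X} {S : Finset X} (hS : ∀ᵐ ω ∂μ, f ω ∈ S) :
    ∀ᵐ ω ∂μ, μ (f ⁻¹' {f ω}) ≠ 0 := by
  have hnull : ∀ x ∈ S, ∀ᵐ ω ∂μ, f ω = x → μ (f ⁻¹' {x}) ≠ 0 := fun x _ => by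
    rcases eq_or_ne (μ (f ⁻¹' {x})) 0 with h0 | h0
    · filter_upwards [measure_eq_zero_iff_ae_notMem.1 h0] with ω hω hx using absurd hx hω
    · exact .of_forall fun _ _ => h0
  filter_upwards [hS, (Finset.eventually_all S).2 hnull] with ω hω h using h _ hω rfl

lemma comp_ae_eq_sum_indicator {f : Ω → X} {S : Finset X} (hS : ∀ᵐ ω ∂μ, f ω ∈ S) (g : X → ℝ) :
    (fun ω => g (f ω)) =ᵐ[μ] fun ω => ∑ x ∈ S, (f ⁻¹' {x}).indicator (fun _ => g x) ω := by
  filter_upwards [hS] with ω hω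
  rw [Finset.sum_eq_single_of_mem (f ω) hω fun x _ hx =>
    Set.indicator_of_notMem (s := f ⁻¹' {x}) hx.symm _]
  exact (Set.indicator_of_mem (s := f ⁻¹' {f ω}) rfl fun _ => g (f ω)).symm

variable [MeasurableSpace X] [MeasurableSingletonClass X] {f : Ω → X}

lemma integrable_comp_of_ae_mem [IsFiniteMeasure μ] (hf : Measurable f) {S : Finset X}
    (hS : ∀ᵐ ω ∂μ, f ω ∈ S) (g : X → ℝ) : Integrable (fun ω => g (f ω)) μ :=
  (integrable_finsetSum S fun x _ => (integrable_const (g x)).indicator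
    (hf (measurableSet_singleton x))).congr (comp_ae_eq_sum_indicator hS g).symm

lemma integrable_of_factorsThrough [IsFiniteMeasure μ] (hf : Measurable f) {S : Finset X}
    (hS : ∀ᵐ ω ∂μ, f ω ∈ S) {φ : Ω → ℝ} (hφ : φ.FactorsThrough f) : Integrable φ μ := by
  rw [show φ = fun ω => Function.extend f φ 0 (f ω) from funext fun ω => (hφ.extend_apply 0 ω).symm]
  exact integrable_comp_of_ae_mem hf hS _

lemma integral_comp_eq_sum [IsFiniteMeasure μ] (hf : Measurable f) {S : Finset X}
    (hS : ∀ᵐ ω ∂μ, f ω ∈ S) (g : X → ℝ) :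
    ∫ ω, g (f ω) ∂μ = ∑ x ∈ S, μ.real (f ⁻¹' {x}) * g x := by
  rw [integral_congr_ae (comp_ae_eq_sum_indicator hS g), integral_finsetSum S fun x _ =>
    (integrable_const (g x)).indicator (hf (measurableSet_singleton x))]
  simp only [integral_indicator_const _ (hf (measurableSet_singleton _)), smul_eq_mul]

lemma condExp_comap_eq_integral_cond [IsFiniteMeasure μ] (hf : Measurable f) {φ : Ω → ℝ}
    (hφ : Integrable φ μ) {ω : Ω} (hω : μ (f ⁻¹' {f ω}) ≠ 0) :
    (μ[φ | MeasurableSpace.comap f inferInstance]) ω = ∫ x, φ x ∂μ[|f ⁻¹' {f ω}] := by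
  have hatom : MeasurableSet[MeasurableSpace.comap f inferInstance] (f ⁻¹' {f ω}) :=
    ⟨{f ω}, measurableSet_singleton _, rfl⟩
  have hconst := (stronglyMeasurable_condExp (μ := μ) (f := φ)
    (m := MeasurableSpace.comap f inferInstance)).factorsThrough
  have hset : ∫ x in f ⁻¹' {f ω}, φ x ∂μ =
      μ.real (f ⁻¹' {f ω}) * (μ[φ | MeasurableSpace.comap f inferInstance]) ω := by
    rw [← setIntegral_condExp hf.comap_le hφ hatom,
      setIntegral_congr_fun (hf.comap_le _ hatom) fun x hx => hconst hx, setIntegral_const,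
      smul_eq_mul]
  have hpos : μ.real (f ⁻¹' {f ω}) ≠ 0 := (measureReal_ne_zero_iff).2 hω
  rw [ProbabilityTheory.cond, integral_smul_measure, hset, ENNReal.toReal_inv, smul_eq_mul]
  exact (inv_mul_cancel_left₀ hpos _).symm

end FiniteRange

lemma history_succ_eq_iff {Ω : Type*} {K : ℕ} {A : ℕ → Ω → Fin K} {R : ℕ → Ω → Fin K → I} {t : ℕ}
    {ω ω' : Ω} :
    history A R (t + 1) ω' = history A R (t + 1) ω ↔
      history A R t ω' = history A R t ω ∧
        A t ω' = A t ω ∧ R (t + 1) ω' (A t ω) = R (t + 1) ω (A t ω) := by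
  simp only [funext_iff, Fin.forall_fin_succ', history, Prod.ext_iff, Fin.val_castSucc,
    Fin.val_last]
  refine and_congr_right fun _ => and_congr_right fun h => ?_
  rw [h]

namespace BayesianBandit

variable {Ω : Type*} [MeasurableSpace Ω] {K : ℕ} {μ : Measure Ω} (B : BayesianBandit K μ)

/-- The event that the history `H_t` is the one observed at `ω`. -/
def atom (t : ℕ) (ω : Ω) : Set Ω := history B.A B.R t ⁻¹' {history B.A B.R t ω}

/-- The conditional probability `ℙ_t`, as an elementary conditional probability given the observed
history. It is the zero measure if `B.atom t ω` is a null set. -/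
def condProb (t : ℕ) (ω : Ω) : Measure Ω := μ[|B.atom t ω]

/-- The event that the reward vector `R (s + 1)` lies in `C s` for all `s ∈ S`. -/
def rewardCylinder (S : Finset ℕ) (C : ℕ → Set (Fin K → I)) : Set Ω :=
  ⋂ s ∈ S, B.R (s + 1) ⁻¹' C s

/-- The σ-algebra generated by `H_t`, `p_*`, `A_*` and all the reward vectors. -/
abbrev fullSigma (t : ℕ) : MeasurableSpace Ω :=
  historySigma B.A B.R t ⊔ MeasurableSpace.comap B.pStar inferInstance ⊔
    MeasurableSpace.comap B.AStar inferInstance ⊔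
    ⨆ s, MeasurableSpace.comap (B.R (s + 1)) inferInstance

/-- Given the optimal action `i`, the reward vectors are i.i.d. with distribution `P i`. -/
def IsIIDGivenAStar (P : Fin K → RewardLaw K) : Prop :=
  ∀ (i : Fin K) (S : Finset ℕ) (C : ℕ → Set (Fin K → I)), (∀ s, MeasurableSet (C s)) →
    μ.real (B.AStar ⁻¹' {i} ∩ B.rewardCylinder S C) =
      μ.real (B.AStar ⁻¹' {i}) * ∏ s ∈ S, (P i : Measure (Fin K → I)).real (C s)

section Measurability

lemma measurable_action_reward (t : ℕ) :
    Measurable fun ω => (B.A t ω, B.R (t + 1) ω (B.A t ω)) := by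
  have heval : Measurable fun x : (Fin K → I) × Fin K => x.1 x.2 :=
    measurable_from_prod_countable_left fun a => measurable_pi_apply a
  exact (B.measurable_A t).prodMk (heval.comp ((B.measurable_R (t + 1)).prodMk (B.measurable_A t)))

lemma measurable_history (t : ℕ) : Measurable (history B.A B.R t) :=
  measurable_pi_lambda _ fun s => B.measurable_action_reward s

lemma measurableSet_AStar (i : Fin K) : MeasurableSet (B.AStar ⁻¹' {i}) :=
  B.measurable_AStar (measurableSet_singleton i)

lemma measurableSet_A (t : ℕ) (a : Fin K) : MeasurableSet (B.A t ⁻¹' {a}) :=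
  B.measurable_A t (measurableSet_singleton a)

lemma measurableSet_atom (t : ℕ) (ω : Ω) : MeasurableSet (B.atom t ω) :=
  B.measurable_history t (measurableSet_singleton _)

lemma measurableSet_eval_eq (a : Fin K) (y : I) : MeasurableSet {r : Fin K → I | r a = y} :=
  measurableSet_eq_fun (measurable_pi_apply a) measurable_const

lemma fullSigma_le (t : ℕ) : B.fullSigma t ≤ ‹MeasurableSpace Ω› :=
  sup_le (sup_le (sup_le (B.measurable_history t).comap_le B.measurable_pStar.comap_le)
    B.measurable_AStar.comap_le) (iSup_le fun s => (B.measurable_R (s + 1)).comap_le)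

lemma measurableSet_fullSigma_atom (t : ℕ) (ω : Ω) :
    MeasurableSet[B.fullSigma t] (B.atom t ω) :=
  (le_sup_left.trans (le_sup_left.trans le_sup_left) : historySigma B.A B.R t ≤ B.fullSigma t) _
    ⟨_, measurableSet_singleton _, rfl⟩

lemma measurableSet_fullSigma_AStar (t : ℕ) (i : Fin K) :
    MeasurableSet[B.fullSigma t] (B.AStar ⁻¹' {i}) :=
  (le_sup_right.trans le_sup_left :
    MeasurableSpace.comap B.AStar inferInstance ≤ B.fullSigma t) _
    ⟨_, measurableSet_singleton _, rfl⟩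

lemma measurableSet_fullSigma_R (t s : ℕ) {C : Set (Fin K → I)} (hC : MeasurableSet C) :
    MeasurableSet[B.fullSigma t] (B.R (s + 1) ⁻¹' C) :=
  ((le_iSup (fun s => MeasurableSpace.comap (B.R (s + 1)) inferInstance) s).trans le_sup_right :
    MeasurableSpace.comap (B.R (s + 1)) inferInstance ≤ B.fullSigma t) _ ⟨C, hC, rfl⟩

lemma measurableSet_fullSigma_rewardCylinder (t : ℕ) (S : Finset ℕ) {C : ℕ → Set (Fin K → I)}
    (hC : ∀ s, MeasurableSet (C s)) : MeasurableSet[B.fullSigma t] (B.rewardCylinder S C) :=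
  @Finset.measurableSet_biInter _ _ (_) _ S fun s _ => B.measurableSet_fullSigma_R t s (hC s)

end Measurability

section Atoms

variable {t : ℕ} {ω ω' : Ω}

lemma atom_zero (ω : Ω) : B.atom 0 ω = Set.univ :=
  Set.eq_univ_of_forall fun _ => Subsingleton.elim _ _

lemma atom_succ (t : ℕ) (ω : Ω) :
    B.atom (t + 1) ω = B.atom t ω ∩ (B.A t ⁻¹' {B.A t ω} ∩
      B.R (t + 1) ⁻¹' {r | r (B.A t ω) = B.R (t + 1) ω (B.A t ω)}) :=
  Set.ext fun _ => history_succ_eq_iff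

lemma posterior_congr (h : history B.A B.R t ω' = history B.A B.R t ω) :
    B.posterior t ω' = B.posterior t ω :=
  funext fun _ => stronglyMeasurable_condExp.factorsThrough h

lemma actionProb_congr (h : history B.A B.R t ω' = history B.A B.R t ω) :
    B.actionProb t ω' = B.actionProb t ω :=
  funext fun _ => stronglyMeasurable_condExp.factorsThrough h

variable {B}

lemma real_condProb (t : ℕ) (ω : Ω) (E : Set Ω) :
    (B.condProb t ω).real E = (μ.real (B.atom t ω))⁻¹ * μ.real (B.atom t ω ∩ E) :=
  real_cond (B.measurableSet_atom t ω) E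

variable [IsProbabilityMeasure μ]

lemma condProb_succ (t : ℕ) (ω : Ω) :
    B.condProb (t + 1) ω = (B.condProb t ω)[|B.A t ⁻¹' {B.A t ω} ∩
      B.R (t + 1) ⁻¹' {r | r (B.A t ω) = B.R (t + 1) ω (B.A t ω)}] := by
  rw [condProb, condProb, cond_cond_eq_cond_inter (B.measurableSet_atom t ω), ← atom_succ]
  exact (B.measurableSet_A t _).inter (B.measurable_R _ (measurableSet_eval_eq _ _))

lemma condExp_hist_eq {f : Ω → ℝ} (hf : Integrable f μ) (hω : μ (B.atom t ω) ≠ 0) :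
    (μ[f | B.hist t]) ω = ∫ x, f x ∂B.condProb t ω :=
  condExp_comap_eq_integral_cond (B.measurable_history t) hf hω

lemma condExp_hist_indicator_eq {E : Set Ω} (hE : MeasurableSet E) (hω : μ (B.atom t ω) ≠ 0) :
    (μ⟦E | B.hist t⟧) ω = (B.condProb t ω).real E := by
  rw [condExp_hist_eq ((integrable_const _).indicator hE) hω, integral_indicator_const _ hE,
    smul_eq_mul, mul_one]

lemma posterior_eq (hω : μ (B.atom t ω) ≠ 0) (i : Fin K) :
    B.posterior t ω i = (B.condProb t ω).real (B.AStar ⁻¹' {i}) :=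
  condExp_hist_indicator_eq (B.measurableSet_AStar i) hω

lemma isProbabilityMeasure_condProb (hω : μ (B.atom t ω) ≠ 0) :
    IsProbabilityMeasure (B.condProb t ω) :=
  cond_isProbabilityMeasure hω

lemma sum_posterior (hω : μ (B.atom t ω) ≠ 0) : ∑ i, B.posterior t ω i = 1 := by
  have := isProbabilityMeasure_condProb hω
  simpa [posterior_eq hω] using
    (measureReal_eq_sum_inter_preimage (μ := B.condProb t ω) B.measurable_AStar Set.univ).symm

lemma real_inter_action {E : Set Ω} (hE : MeasurableSet[B.fullSigma t] E)
    (hEω : E ⊆ B.atom t ω) (a : Fin K) :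
    μ.real (E ∩ B.A t ⁻¹' {a}) = B.actionProb t ω a * μ.real E := by
  have hEm := B.fullSigma_le t _ hE
  have hA := B.measurableSet_A t a
  calc μ.real (E ∩ B.A t ⁻¹' {a})
      = ∫ x in E, (B.A t ⁻¹' {a}).indicator (fun _ => (1 : ℝ)) x ∂μ := by
        simp [integral_indicator hA, Measure.restrict_restrict hA, Set.inter_comm]
    _ = ∫ x in E, (μ⟦B.A t ⁻¹' {a} | B.fullSigma t⟧) x ∂μ :=
        (setIntegral_condExp (B.fullSigma_le t) ((integrable_const _).indicator hA) hE).symm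
    _ = ∫ x in E, B.actionProb t x a ∂μ :=
        setIntegral_congr_ae hEm ((B.policy t a).mono fun _ hx _ => hx)
    _ = ∫ _ in E, B.actionProb t ω a ∂μ :=
        setIntegral_congr_fun hEm fun _ hx => congrFun (B.actionProb_congr (hEω hx)) a
    _ = B.actionProb t ω a * μ.real E := by
        rw [setIntegral_const, smul_eq_mul, mul_comm]

lemma real_condProb_action_inter {E : Set Ω} (hE : MeasurableSet[B.fullSigma t] E) (ω : Ω)
    (a : Fin K) :
    (B.condProb t ω).real (B.A t ⁻¹' {a} ∩ E) =
      B.actionProb t ω a * (B.condProb t ω).real E := by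
  rw [real_condProb, real_condProb, mul_left_comm,
    ← real_inter_action ((B.measurableSet_fullSigma_atom t ω).inter hE) Set.inter_subset_left,
    Set.inter_comm (B.A t ⁻¹' {a}), Set.inter_assoc]

lemma real_atom_succ_inter {S : Finset ℕ} (hS : t ∉ S) {C : ℕ → Set (Fin K → I)}
    (hC : ∀ s, MeasurableSet (C s)) (ω : Ω) (i : Fin K) :
    μ.real (B.atom (t + 1) ω ∩ (B.AStar ⁻¹' {i} ∩ B.rewardCylinder S C)) =
      B.actionProb t ω (B.A t ω) * μ.real (B.atom t ω ∩ (B.AStar ⁻¹' {i} ∩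
        B.rewardCylinder (insert t S)
          (Function.update C t {r | r (B.A t ω) = B.R (t + 1) ω (B.A t ω)}))) := by
  have hC' : ∀ s, MeasurableSet
      (Function.update C t {r | r (B.A t ω) = B.R (t + 1) ω (B.A t ω)} s) :=
    (Function.forall_update_iff C fun _ => MeasurableSet).2
      ⟨measurableSet_eval_eq _ _, fun s _ => hC s⟩
  have hcylinder : B.rewardCylinder (insert t S)
      (Function.update C t {r | r (B.A t ω) = B.R (t + 1) ω (B.A t ω)}) =
      B.R (t + 1) ⁻¹' {r | r (B.A t ω) = B.R (t + 1) ω (B.A t ω)} ∩ B.rewardCylinder S C := by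
    rw [rewardCylinder, Finset.set_biInter_insert, Function.update_self]
    exact congrArg _ (Set.iInter₂_congr fun s hs => by
      rw [Function.update_of_ne (ne_of_mem_of_not_mem hs hS)])
  rw [← real_inter_action ((B.measurableSet_fullSigma_atom t ω).inter
    ((B.measurableSet_fullSigma_AStar t i).inter
      (B.measurableSet_fullSigma_rewardCylinder t _ hC'))) Set.inter_subset_left, hcylinder,
    atom_succ]
  congr 1
  ext
  simp only [Set.mem_inter_iff]
  tauto

end Atoms

namespace IsIIDGivenAStar

variable {B} [IsProbabilityMeasure μ] {P : Fin K → RewardLaw K} {S : Finset I} {t : ℕ} {ω : Ω}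

-- The probability of each past action is a function of the history, hence a common factor of both
-- sides.
lemma real_atom_inter (hB : B.IsIIDGivenAStar P) (t : ℕ) (ω : Ω) (i : Fin K) {S : Finset ℕ}
    (hS : ∀ s ∈ S, t ≤ s) {C : ℕ → Set (Fin K → I)} (hC : ∀ s, MeasurableSet (C s)) :
    μ.real (B.atom t ω ∩ (B.AStar ⁻¹' {i} ∩ B.rewardCylinder S C)) =
      μ.real (B.atom t ω ∩ B.AStar ⁻¹' {i}) *
        ∏ s ∈ S, (P i : Measure (Fin K → I)).real (C s) := by
  induction t generalizing S C with
  | zero => simpa [atom_zero] using hB i S C hC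
  | succ t ih =>
    set D := {r : Fin K → I | r (B.A t ω) = B.R (t + 1) ω (B.A t ω)}
    have hsucc : ∀ T : Finset ℕ, (∀ s ∈ T, t + 1 ≤ s) →
        μ.real (B.atom (t + 1) ω ∩ (B.AStar ⁻¹' {i} ∩ B.rewardCylinder T C)) =
          B.actionProb t ω (B.A t ω) * (μ.real (B.atom t ω ∩ B.AStar ⁻¹' {i}) *
            ((P i : Measure (Fin K → I)).real D *
              ∏ s ∈ T, (P i : Measure (Fin K → I)).real (C s))) := fun T hT => by
      have htT : t ∉ T := fun ht => absurd (hT t ht) (by simp)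
      rw [real_atom_succ_inter htT hC, ih, Finset.prod_insert htT, Function.update_self,
        Finset.prod_congr rfl fun s hs => by
          rw [Function.update_of_ne (ne_of_mem_of_not_mem hs htT)]]
      · exact fun s hs => (Finset.mem_insert.1 hs).elim ge_of_eq
          fun hs => t.le_succ.trans (hT s hs)
      · exact (Function.forall_update_iff C fun _ => MeasurableSet).2
          ⟨measurableSet_eval_eq _ _, fun s _ => hC s⟩
    have hempty := hsucc ∅ (by simp)
    rw [Finset.prod_empty, mul_one, rewardCylinder] at hempty
    simp only [Finset.notMem_empty, Set.iInter_of_empty, Set.iInter_univ, Set.inter_univ] at hempty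
    rw [hsucc S hS, hempty]
    ring

lemma real_condProb_AStar_inter_reward (hB : B.IsIIDGivenAStar P) (hω : μ (B.atom t ω) ≠ 0)
    (i : Fin K) {C : Set (Fin K → I)} (hC : MeasurableSet C) :
    (B.condProb t ω).real (B.AStar ⁻¹' {i} ∩ B.R (t + 1) ⁻¹' C) =
      B.posterior t ω i * (P i : Measure (Fin K → I)).real C := by
  have hatom := hB.real_atom_inter t ω i (S := {t}) (C := fun _ => C) (by simp) fun _ => hC
  rw [rewardCylinder, Finset.set_biInter_singleton, Finset.prod_singleton] at hatom
  rw [real_condProb, hatom, posterior_eq hω, real_condProb, mul_assoc]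

lemma real_condProb_reward (hB : B.IsIIDGivenAStar P) (hω : μ (B.atom t ω) ≠ 0) (a : Fin K)
    (y : I) :
    (B.condProb t ω).real (B.R (t + 1) ⁻¹' {r | r a = y}) =
      evidence (armLikelihood P a) (B.posterior t ω) y := by
  have := isProbabilityMeasure_condProb hω
  rw [measureReal_eq_sum_inter_preimage B.measurable_AStar]
  simp only [hB.real_condProb_AStar_inter_reward hω _ (measurableSet_eval_eq a y)]
  rfl

lemma real_condProb_action_inter_reward (hB : B.IsIIDGivenAStar P) (hω : μ (B.atom t ω) ≠ 0)
    (a : Fin K) (y : I) :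
    (B.condProb t ω).real (B.A t ⁻¹' {a} ∩ B.R (t + 1) ⁻¹' {r | r a = y}) =
      B.actionProb t ω a * evidence (armLikelihood P a) (B.posterior t ω) y := by
  rw [real_condProb_action_inter
    (B.measurableSet_fullSigma_R t t (measurableSet_eval_eq a y)), hB.real_condProb_reward hω]

lemma posterior_succ (hB : B.IsIIDGivenAStar P) (hω : μ (B.atom (t + 1) ω) ≠ 0) :
    B.posterior (t + 1) ω = bayesUpdate (armLikelihood P (B.A t ω)) (B.posterior t ω)
      (B.R (t + 1) ω (B.A t ω)) := by
  set a := B.A t ω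
  set y := B.R (t + 1) ω a
  have hωt : μ (B.atom t ω) ≠ 0 :=
    fun h => hω (measure_mono_null (B.atom_succ t ω ▸ Set.inter_subset_left) h)
  have hR := B.measurableSet_fullSigma_R t t (measurableSet_eval_eq a y)
  have haction : B.actionProb t ω a ≠ 0 := fun h => hω <| by
    rw [← measureReal_eq_zero_iff, atom_succ, Set.inter_comm (B.A t ⁻¹' _), ← Set.inter_assoc,
      real_inter_action ((B.measurableSet_fullSigma_atom t ω).inter hR) Set.inter_subset_left, h,
      zero_mul]
  funext i
  rw [posterior_eq hω, condProb_succ, real_cond ((B.measurableSet_A t a).inter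
      (B.fullSigma_le t _ hR)), hB.real_condProb_action_inter_reward hωt, Set.inter_assoc,
    real_condProb_action_inter (hR.inter (B.measurableSet_fullSigma_AStar t i)),
    Set.inter_comm _ (B.AStar ⁻¹' {i}),
    hB.real_condProb_AStar_inter_reward hωt i (measurableSet_eval_eq a y), ← div_eq_inv_mul,
    mul_div_mul_left _ _ haction]
  rfl

variable (hB : B.IsIIDGivenAStar P) (hS : ∀ i a, ∀ᵐ r ∂(P i : Measure (Fin K → I)), r a ∈ S)

include hB hS

lemma ae_reward_mem (t : ℕ) (a : Fin K) : ∀ᵐ ω ∂μ, B.R (t + 1) ω a ∈ S := by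
  set C := {r : Fin K → I | r a ∉ S}
  have hC : MeasurableSet C := by
    have heval : Measurable fun r : Fin K → I => r a := measurable_pi_apply a
    exact (heval S.measurableSet).compl
  have hnull : ∀ i, μ.real (B.AStar ⁻¹' {i} ∩ B.R (t + 1) ⁻¹' C) = 0 := fun i => by
    have hiid := hB i {t} (fun _ => C) fun _ => hC
    have hPC : (P i : Measure (Fin K → I)).real C = 0 := by
      rw [measureReal_eq_zero_iff]
      exact ae_iff.1 (hS i a)
    rwa [rewardCylinder, Finset.set_biInter_singleton, Finset.prod_singleton, hPC,
      mul_zero] at hiid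
  rw [ae_iff, ← measureReal_eq_zero_iff]
  exact (measureReal_eq_sum_inter_preimage B.measurable_AStar _).trans
    (Finset.sum_eq_zero fun i _ => hnull i)

lemma ae_history_mem (t : ℕ) :
    ∀ᵐ ω ∂μ, history B.A B.R t ω ∈ Fintype.piFinset fun _ => Finset.univ ×ˢ S := by
  filter_upwards [ae_all_iff.2 fun s : Fin t => ae_all_iff.2 fun a => hB.ae_reward_mem hS s a]
    with ω hω
  exact Fintype.mem_piFinset.2 fun s => Finset.mem_product.2 ⟨Finset.mem_univ _, hω s _⟩

lemma ae_atom_ne_zero (t : ℕ) : ∀ᵐ ω ∂μ, μ (B.atom t ω) ≠ 0 :=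
  ae_measure_preimage_ne_zero (hB.ae_history_mem hS t)

lemma integrable_comp_posterior (φ : (Fin K → ℝ) → ℝ) (t : ℕ) :
    Integrable (fun ω => φ (B.posterior t ω)) μ :=
  integrable_of_factorsThrough (B.measurable_history t) (hB.ae_history_mem hS t)
    fun _ _ h => congrArg φ (B.posterior_congr h)

lemma integrable_comp_posterior_action_reward (Φ : (Fin K → ℝ) → Fin K → I → ℝ) (t : ℕ) :
    Integrable (fun ω => Φ (B.posterior t ω) (B.A t ω) (B.R (t + 1) ω (B.A t ω))) μ :=
  integrable_of_factorsThrough (B.measurable_history (t + 1)) (hB.ae_history_mem hS (t + 1))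
    fun _ _ h => by
      obtain ⟨hhist, hA, hR⟩ := history_succ_eq_iff.1 h
      simp only [B.posterior_congr hhist, hA, hR]

lemma condExp_posterior_action_reward (Φ : (Fin K → ℝ) → Fin K → I → ℝ) (t : ℕ) :
    ∀ᵐ ω ∂μ, (μ[fun ω' => Φ (B.posterior t ω') (B.A t ω') (B.R (t + 1) ω' (B.A t ω')) |
        B.hist t]) ω =
      predictiveMean S (armLikelihood P) (B.actionProb t ω) (B.posterior t ω)
        (Φ (B.posterior t ω)) := by
  filter_upwards [hB.ae_atom_ne_zero hS t] with ω hω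
  have := isProbabilityMeasure_condProb hω
  have hposterior : ∀ᵐ ω' ∂B.condProb t ω, B.posterior t ω' = B.posterior t ω :=
    (ae_cond_mem (B.measurableSet_atom t ω)).mono fun _ h => B.posterior_congr h
  have hmem : ∀ᵐ ω' ∂B.condProb t ω,
      (B.A t ω', B.R (t + 1) ω' (B.A t ω')) ∈ Finset.univ ×ˢ S := by
    refine cond_absolutelyContinuous.ae_le ?_
    filter_upwards [ae_all_iff.2 fun a => hB.ae_reward_mem hS t a] with ω' hω'
    exact Finset.mem_product.2 ⟨Finset.mem_univ _, hω' _⟩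
  have hpreimage : ∀ (a : Fin K) (y : I),
      (fun ω' => (B.A t ω', B.R (t + 1) ω' (B.A t ω'))) ⁻¹' {(a, y)} =
        B.A t ⁻¹' {a} ∩ B.R (t + 1) ⁻¹' {r | r a = y} := fun a y => by
    ext ω'
    simp +contextual [Prod.ext_iff]
  rw [condExp_hist_eq (hB.integrable_comp_posterior_action_reward hS Φ t) hω,
    integral_congr_ae (hposterior.mono fun ω' h => by rw [h]),
    integral_comp_eq_sum (B.measurable_action_reward t) hmem
      fun z => Φ (B.posterior t ω) z.1 z.2, Finset.sum_product, predictiveMean]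
  simp only [hpreimage, hB.real_condProb_action_inter_reward hω, Finset.mul_sum, mul_assoc]

lemma ae_posterior_pos (hprior : ∀ i, 0 < μ.real (B.AStar ⁻¹' {i}))
    (hP : ∀ a i, ∀ y ∈ S, 0 < armLikelihood P a i y) (t : ℕ) :
    ∀ᵐ ω ∂μ, ∀ i, 0 < B.posterior t ω i := by
  induction t with
  | zero =>
    refine .of_forall fun ω i => ?_
    rw [posterior_eq (by simp [atom_zero]), condProb, atom_zero, cond_univ]
    exact hprior i
  | succ t ih =>
    filter_upwards [ih, hB.ae_atom_ne_zero hS (t + 1),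
      ae_all_iff.2 fun a => hB.ae_reward_mem hS t a] with ω hpos hω hR
    have : Nonempty (Fin K) := ⟨B.AStar ω⟩
    rw [hB.posterior_succ hω]
    exact bayesUpdate_pos hpos fun i => hP _ i _ (hR _)

lemma condExp_comp_posterior_succ (φ : (Fin K → ℝ) → ℝ) (t : ℕ) :
    ∀ᵐ ω ∂μ, (μ[fun ω' => φ (B.posterior (t + 1) ω') | B.hist t]) ω =
      predictiveMean S (armLikelihood P) (B.actionProb t ω) (B.posterior t ω)
        fun a y => φ (bayesUpdate (armLikelihood P a) (B.posterior t ω) y) := by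
  have hsucc : (fun ω => φ (B.posterior (t + 1) ω)) =ᵐ[μ] fun ω =>
      φ (bayesUpdate (armLikelihood P (B.A t ω)) (B.posterior t ω) (B.R (t + 1) ω (B.A t ω))) := by
    filter_upwards [hB.ae_atom_ne_zero hS (t + 1)] with ω hω
    rw [hB.posterior_succ hω]
  filter_upwards [condExp_congr_ae (m := B.hist t) hsucc, hB.condExp_posterior_action_reward hS
    (fun α a y => φ (bayesUpdate (armLikelihood P a) α y)) t] with ω h₁ h₂ using h₁.trans h₂

lemma policyInfoGain_eq (F : (Fin K → ℝ) → ℝ) (t : ℕ) :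
    ∀ᵐ ω ∂μ, B.policyInfoGain F t ω =
      predictiveMean S (armLikelihood P) (B.actionProb t ω) (B.posterior t ω) fun a y =>
        bregman F (bayesUpdate (armLikelihood P a) (B.posterior t ω) y) (B.posterior t ω) := by
  have hsucc : ∀ a, (B.A t ⁻¹' {a}).indicator
      (fun ω => bregman F (B.posterior (t + 1) ω) (B.posterior t ω)) =ᵐ[μ] fun ω =>
        if B.A t ω = a then bregman F (bayesUpdate (armLikelihood P (B.A t ω)) (B.posterior t ω)
          (B.R (t + 1) ω (B.A t ω))) (B.posterior t ω) else 0 := fun a => by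
    filter_upwards [hB.ae_atom_ne_zero hS (t + 1)] with ω hω
    simp only [Set.indicator, Set.mem_preimage, Set.mem_singleton_iff, hB.posterior_succ hω]
  filter_upwards [ae_all_iff.2 fun a => condExp_congr_ae (m := B.hist t) (hsucc a),
    ae_all_iff.2 fun a => hB.condExp_posterior_action_reward hS (fun α b y =>
      if b = a then bregman F (bayesUpdate (armLikelihood P b) α y) α else 0) t] with ω h₁ h₂
  refine Finset.sum_congr rfl fun a _ => ?_
  rw [infoGain, h₁ a, h₂ a, predictiveMean, Finset.sum_eq_single a (fun b _ hb => by simp [hb])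
    (by simp)]
  simp only [if_true]
  rw [mul_div_assoc']
  exact mul_div_cancel_left_of_imp fun h => by rw [h, zero_mul]

lemma condExp_reward_eq (t : ℕ) (a : Fin K) :
    ∀ᵐ ω ∂μ, (μ[fun ω' => (B.R (t + 1) ω' a : ℝ) | B.hist t]) ω =
      ∑ y ∈ S, evidence (armLikelihood P a) (B.posterior t ω) y * y := by
  have hRa : Measurable fun ω => B.R (t + 1) ω a :=
    (measurable_pi_apply a).comp (B.measurable_R (t + 1))
  filter_upwards [hB.ae_atom_ne_zero hS t] with ω hω
  have := isProbabilityMeasure_condProb hω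
  have hmem : ∀ᵐ ω' ∂B.condProb t ω, B.R (t + 1) ω' a ∈ S :=
    cond_absolutelyContinuous.ae_le (hB.ae_reward_mem hS t a)
  rw [condExp_hist_eq (integrable_comp_of_ae_mem hRa (hB.ae_reward_mem hS t a) _) hω,
    integral_comp_eq_sum hRa hmem fun y => (y : ℝ)]
  exact Finset.sum_congr rfl fun y _ =>
    congrArg (· * (y : ℝ)) (hB.real_condProb_reward hω a y)

end IsIIDGivenAStar

end BayesianBandit

lemma measurable_meanReward {K : ℕ} (a : Fin K) :
    Measurable fun ν : RewardLaw K => meanReward ν a := by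
  have hcoord : Measurable fun r : Fin K → I => (r a : ℝ) :=
    measurable_subtype_coe.comp (measurable_pi_apply a)
  have hlintegral : ∀ ν : RewardLaw K, meanReward ν a =
      (∫⁻ r, ENNReal.ofReal (r a : ℝ) ∂(ν : Measure (Fin K → I))).toReal := fun _ =>
    integral_eq_lintegral_of_nonneg_ae (.of_forall fun r => (r a).2.1) hcoord.aestronglyMeasurable
  simp only [hlintegral]
  exact ((Measure.measurable_lintegral hcoord.ennreal_ofReal).comp
    measurable_subtype_coe).ennreal_toReal

lemma measurable_rewardLaw_real {K : ℕ} {C : Set (Fin K → I)} (hC : MeasurableSet C) :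
    Measurable fun ν : RewardLaw K => (ν : Measure (Fin K → I)).real C :=
  ((Measure.measurable_coe hC).comp measurable_subtype_coe).ennreal_toReal

lemma uniformPrior_apply {K : ℕ} (P : Fin K → RewardLaw K) {s : Set (RewardLaw K)}
    (hs : MeasurableSet s) : uniformPrior P s = (K : ℝ≥0∞)⁻¹ * ∑ j, s.indicator 1 (P j) := by
  simp [uniformPrior, Measure.dirac_apply' _ hs, Finset.mul_sum]

lemma ae_uniformPrior {K : ℕ} {P : Fin K → RewardLaw K} {Q : RewardLaw K → Prop}
    (hQm : MeasurableSet {ν | Q ν}) (hQ : ∀ j, Q (P j)) : ∀ᵐ ν ∂uniformPrior P, Q ν := by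
  rw [ae_iff, ← Set.compl_ofPred, uniformPrior_apply P hQm.compl]
  simp [hQ]

namespace BayesianBandit

variable {Ω : Type*} [MeasurableSpace Ω] {K : ℕ} {μ : Measure Ω} {B : BayesianBandit K μ}
  {p ε : ℝ} {P : Fin K → RewardLaw K}

section UniformPrior

variable (hε : 0 < ε) (hP : HasHardMarginals p ε P) (hprior : μ.map B.pStar = uniformPrior P)

include hε hP hprior

-- The mean rewards under `p_*^j` determine `j`, and by optimality `j = A_*`.
lemma ae_comp_pStar_eq {X : Type*} [MeasurableSpace X] [MeasurableSingletonClass X]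
    {f : RewardLaw K → X} (hf : Measurable f) : ∀ᵐ ω ∂μ, f (B.pStar ω) = f (P (B.AStar ω)) := by
  have hQ : MeasurableSet {ν : RewardLaw K |
      ∃ j, (∀ k, meanReward ν k = hardMean p ε j k) ∧ f ν = f (P j)} := by
    simp only [Set.ofPred_exists, Set.ofPred_and, Set.ofPred_forall]
    exact .iUnion fun j => .inter
      (.iInter fun k => measurable_meanReward k (measurableSet_singleton _))
      (hf (measurableSet_singleton _))
  filter_upwards [B.optimal, ae_of_ae_map B.measurable_pStar.aemeasurable
    (hprior ▸ ae_uniformPrior hQ fun j => ⟨j, hP.meanReward_eq j, rfl⟩)] with ω hopt ⟨j, hmean, hfj⟩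
  have hj : p + ε ≤ hardMean p ε j (B.AStar ω) := by
    rw [← (hardMean_eq_iff hε.ne').2 (rfl : j = j), ← hmean, ← hmean]
    exact hopt j
  rw [hfj, ← (hardMean_eq_iff hε.ne').1 ((hardMean_le hε.le _ _).antisymm hj)]

lemma ae_meanReward_eq : ∀ᵐ ω ∂μ, ∀ k, meanReward (B.pStar ω) k = hardMean p ε (B.AStar ω) k := by
  filter_upwards [ae_all_iff.2 fun k => ae_comp_pStar_eq hε hP hprior (measurable_meanReward k)]
    with ω hω k
  rw [hω, hP.meanReward_eq]

lemma ae_RStar_eq : ∀ᵐ ω ∂μ, B.RStar ω = p + ε := by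
  filter_upwards [ae_meanReward_eq hε hP hprior] with ω hω
  have : Nonempty (Fin K) := ⟨B.AStar ω⟩
  rw [RStar, iSup_congr hω]
  refine le_antisymm (ciSup_le (hardMean_le hε.le _)) ?_
  exact ((hardMean_eq_iff hε.ne').2 rfl).ge.trans
    (le_ciSup (Set.finite_range _).bddAbove (B.AStar ω))

lemma AStar_preimage_ae_eq (i : Fin K) :
    B.AStar ⁻¹' {i} =ᵐ[μ] B.pStar ⁻¹' {ν | meanReward ν i = p + ε} := by
  filter_upwards [ae_meanReward_eq hε hP hprior] with ω hω
  have hi : meanReward (B.pStar ω) i = p + ε ↔ B.AStar ω = i := by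
    rw [hω, hardMean_eq_iff hε.ne']
  exact propext hi.symm

lemma real_AStar (i : Fin K) : μ.real (B.AStar ⁻¹' {i}) = (K : ℝ)⁻¹ := by
  have hmeas : MeasurableSet {ν : RewardLaw K | meanReward ν i = p + ε} :=
    measurable_meanReward i (measurableSet_singleton _)
  rw [measureReal_congr (AStar_preimage_ae_eq hε hP hprior i),
    ← map_measureReal_apply B.measurable_pStar hmeas, hprior, Measure.real,
    uniformPrior_apply P hmeas]
  simp [Set.indicator_apply, hP.meanReward_eq, hardMean_eq_iff hε.ne']

lemma isIIDGivenAStar [IsProbabilityMeasure μ] : B.IsIIDGivenAStar P := fun i S C hC => by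
  set Θ := B.pStar ⁻¹' {ν | meanReward ν i = p + ε}
  have hΘ : MeasurableSet[MeasurableSpace.comap B.pStar inferInstance] Θ :=
    ⟨_, measurable_meanReward i (measurableSet_singleton _), rfl⟩
  have hAΘ := AStar_preimage_ae_eq hε hP hprior i
  have hcylinder : MeasurableSet (B.rewardCylinder S C) :=
    B.fullSigma_le 0 _ (B.measurableSet_fullSigma_rewardCylinder 0 S hC)
  have hlaw : ∀ᵐ ω ∂μ, ω ∈ Θ →
      (μ⟦B.rewardCylinder S C | MeasurableSpace.comap B.pStar inferInstance⟧) ω =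
        ∏ s ∈ S, (P i : Measure (Fin K → I)).real (C s) := by
    filter_upwards [B.cond_iid S C hC, hAΘ, ae_all_iff.2 fun s =>
      ae_comp_pStar_eq hε hP hprior (measurable_rewardLaw_real (hC s))] with ω hiid hω hpStar hωΘ
    have hi : B.AStar ω = i := hω.mpr hωΘ
    rw [rewardCylinder, hiid]
    simp only [hpStar, hi]
  calc μ.real (B.AStar ⁻¹' {i} ∩ B.rewardCylinder S C)
      = μ.real (Θ ∩ B.rewardCylinder S C) := measureReal_congr (hAΘ.inter (ae_eq_refl _))
    _ = ∫ ω in Θ, (B.rewardCylinder S C).indicator (fun _ => (1 : ℝ)) ω ∂μ := by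
        simp [setIntegral_indicator hcylinder]
    _ = ∫ ω in Θ, (μ⟦B.rewardCylinder S C | MeasurableSpace.comap B.pStar inferInstance⟧) ω ∂μ :=
        (setIntegral_condExp B.measurable_pStar.comap_le
          ((integrable_const _).indicator hcylinder) hΘ).symm
    _ = ∫ _ in Θ, ∏ s ∈ S, (P i : Measure (Fin K → I)).real (C s) ∂μ :=
        setIntegral_congr_ae (B.measurable_pStar.comap_le _ hΘ) hlaw
    _ = μ.real (B.AStar ⁻¹' {i}) * ∏ s ∈ S, (P i : Measure (Fin K → I)).real (C s) := by
        rw [setIntegral_const, smul_eq_mul, measureReal_congr hAΘ]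

end UniformPrior

/-- The expected regret of the single step `t`. -/
def stepRegret {Ω : Type*} [MeasurableSpace Ω] {K : ℕ} {μ : Measure Ω} (B : BayesianBandit K μ)
    (t : ℕ) : ℝ :=
  ∫ ω, B.RStar ω - (B.R (t + 1) ω (B.A t ω) : ℝ) ∂μ

variable {Ω : Type*} [MeasurableSpace Ω] {K : ℕ} {μ : Measure Ω} {B : BayesianBandit K μ}

lemma IsThompsonSampling.ae_actionProb_eq (hTS : B.IsThompsonSampling) (t : ℕ) :
    ∀ᵐ ω ∂μ, B.actionProb t ω = B.posterior t ω :=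
  (ae_all_iff.2 (hTS t)).mono fun _ h => funext h

section HardMarginals

variable [IsProbabilityMeasure μ] {p ε : ℝ} {P : Fin K → RewardLaw K}

section PositiveGap

variable (hε : 0 < ε) (hP : HasHardMarginals p ε P) (hprior : μ.map B.pStar = uniformPrior P)

include hε hP hprior

lemma ae_sum_posterior (t : ℕ) : ∀ᵐ ω ∂μ, ∑ i, B.posterior t ω i = 1 :=
  ((isIIDGivenAStar hε hP hprior).ae_atom_ne_zero hP.ae_mem t).mono fun _ hω => sum_posterior hω

lemma integrable_comp_posterior (φ : (Fin K → ℝ) → ℝ) (t : ℕ) :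
    Integrable (fun ω => φ (B.posterior t ω)) μ :=
  (isIIDGivenAStar hε hP hprior).integrable_comp_posterior hP.ae_mem φ t

lemma expRegret_eq (t : ℕ) (a : Fin K) :
    ∀ᵐ ω ∂μ, B.expRegret t a ω = ε * (1 - B.posterior t ω a) := by
  have hB := isIIDGivenAStar hε hP hprior
  have hRStar : (fun ω => B.RStar ω - (B.R (t + 1) ω a : ℝ)) =ᵐ[μ]
      (fun _ => p + ε) - fun ω => (B.R (t + 1) ω a : ℝ) :=
    (ae_RStar_eq hε hP hprior).mono fun ω hω => congrArg (· - (B.R (t + 1) ω a : ℝ)) hω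
  have hR : Integrable (fun ω => (B.R (t + 1) ω a : ℝ)) μ :=
    integrable_comp_of_ae_mem ((measurable_pi_apply a).comp (B.measurable_R (t + 1)))
      (hB.ae_reward_mem hP.ae_mem t a) _
  filter_upwards [condExp_congr_ae (m := B.hist t) hRStar,
    condExp_sub (integrable_const (p + ε)) hR (B.hist t), hB.condExp_reward_eq hP.ae_mem t a,
    ae_sum_posterior hε hP hprior t] with ω hcongr hsub hreward hsum
  rw [expRegret, hcongr, hsub, Pi.sub_apply, condExp_const (B.measurable_history t).comap_le,
    hreward, Finset.sum_pair zero_ne_one, hP.evidence_one hsum, Set.Icc.coe_zero, Set.Icc.coe_one]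
  ring

lemma integrable_regret (t : ℕ) :
    Integrable (fun ω => B.RStar ω - (B.R (t + 1) ω (B.A t ω) : ℝ)) μ :=
  ((isIIDGivenAStar hε hP hprior).integrable_comp_posterior_action_reward hP.ae_mem
    (fun _ _ y => p + ε - y) t).congr
      ((ae_RStar_eq hε hP hprior).mono fun _ hω => congrArg (· - (_ : ℝ)) hω.symm)

lemma regret_eq_sum_stepRegret (T : ℕ) : B.regret T = ∑ t ∈ Finset.range T, B.stepRegret t :=
  integral_finsetSum _ fun t _ => integrable_regret hε hP hprior t

variable (hTS : B.IsThompsonSampling)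

include hTS

lemma policyRegret_eq (t : ℕ) :
    ∀ᵐ ω ∂μ, B.policyRegret t ω = thompsonRegret ε (B.posterior t ω) := by
  filter_upwards [ae_all_iff.2 fun a => expRegret_eq hε hP hprior t a, hTS.ae_actionProb_eq t,
    ae_sum_posterior hε hP hprior t] with ω hregret haction hsum
  simp only [policyRegret, hregret, haction, thompsonRegret_eq_sum hsum]

lemma stepRegret_eq (t : ℕ) :
    B.stepRegret t = ∫ ω, thompsonRegret ε (B.posterior t ω) ∂μ := by
  have hB := isIIDGivenAStar hε hP hprior
  rw [stepRegret, integral_congr_ae ((ae_RStar_eq hε hP hprior).mono fun ω hω =>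
      congrArg (· - (B.R (t + 1) ω (B.A t ω) : ℝ)) hω),
    ← integral_condExp (B.measurable_history t).comap_le]
  refine integral_congr_ae ?_
  filter_upwards [hB.condExp_posterior_action_reward hP.ae_mem (fun _ _ y => p + ε - y) t,
    hTS.ae_actionProb_eq t, ae_sum_posterior hε hP hprior t] with ω hcond haction hsum
  rw [hcond, haction, hP.predictiveMean_sub hsum]

lemma integral_comp_posterior_succ (φ : (Fin K → ℝ) → ℝ) (t : ℕ) :
    ∫ ω, φ (B.posterior (t + 1) ω) ∂μ =
      ∫ ω, predictiveMean {0, 1} (armLikelihood P) (B.posterior t ω) (B.posterior t ω)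
        (fun a y => φ (bayesUpdate (armLikelihood P a) (B.posterior t ω) y)) ∂μ := by
  have hB := isIIDGivenAStar hε hP hprior
  rw [← integral_condExp (B.measurable_history t).comap_le]
  refine integral_congr_ae ?_
  filter_upwards [hB.condExp_comp_posterior_succ hP.ae_mem φ t, hTS.ae_actionProb_eq t]
    with ω hcond haction
  rw [hcond, haction]

end PositiveGap

variable (hp : p ∈ Set.Ioo 0 1) (hε : ε ∈ Set.Ioo 0 (1 - p)) (hP : HasHardMarginals p ε P)
  (hprior : μ.map B.pStar = uniformPrior P)

include hp hε hP hprior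

lemma ae_posterior_pos_and_sum (t : ℕ) :
    ∀ᵐ ω ∂μ, (∀ i, 0 < B.posterior t ω i) ∧ ∑ i, B.posterior t ω i = 1 := by
  have hAStar : ∀ i, 0 < μ.real (B.AStar ⁻¹' {i}) := fun i => by
    rw [real_AStar hε.1 hP hprior, inv_pos, Nat.cast_pos]
    exact i.pos
  exact ((isIIDGivenAStar hε.1 hP hprior).ae_posterior_pos hP.ae_mem hAStar
    (fun a i _ hy => hP.armLikelihood_pos hp hε a i hy) t).and (ae_sum_posterior hε.1 hP hprior t)

variable (hTS : B.IsThompsonSampling)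

include hTS

lemma infoRatio_le [Nontrivial (Fin K)] (t : ℕ) :
    ∀ᵐ ω ∂μ, 0 < B.policyInfoGain negentropy t ω ∧
      B.infoRatio negentropy t ω ≤
        (1 + B.maxPosterior t ω) ^ 2 / (2 * B.maxPosterior t ω ^ 2) := by
  have hB := isIIDGivenAStar hε.1 hP hprior
  filter_upwards [policyRegret_eq hε.1 hP hprior hTS t,
    hB.policyInfoGain_eq hP.ae_mem negentropy t, hTS.ae_actionProb_eq t,
    ae_posterior_pos_and_sum hp hε hP hprior t] with ω hregret hgain haction ⟨hpos, hsum⟩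
  rw [infoRatio, hregret, hgain, haction]
  exact sq_thompsonRegret_div_le hε.1 hpos hsum (le_predictiveMean_bregman hP hp hε hpos hsum)

-- The posterior is a martingale, hence `∑ i, α i ^ 2` increases in expectation along it.
lemma stepRegret_antitone : Antitone B.stepRegret := by
  refine antitone_nat_of_succ_le fun t => ?_
  rw [stepRegret_eq hε.1 hP hprior hTS, stepRegret_eq hε.1 hP hprior hTS,
    integral_comp_posterior_succ hε.1 hP hprior hTS]
  refine integral_mono_ae (integrable_comp_posterior hε.1 hP hprior (fun α =>
      predictiveMean {0, 1} (armLikelihood P) α α fun a y =>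
        thompsonRegret ε (bayesUpdate (armLikelihood P a) α y)) t)
    (integrable_comp_posterior hε.1 hP hprior (thompsonRegret ε) t) ?_
  filter_upwards [ae_posterior_pos_and_sum hp hε hP hprior t] with ω ⟨hpos, hsum⟩
  exact hP.predictiveMean_thompsonRegret_le hp hε hpos hsum

lemma sq_stepRegret_le (t : ℕ) :
    B.stepRegret t ^ 2 ≤
      √K * (∫ ω, tsallis (B.posterior t ω) ∂μ - ∫ ω, tsallis (B.posterior (t + 1) ω) ∂μ) := by
  have hint := fun φ => integrable_comp_posterior hε.1 hP hprior φ t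
  have hint' := hint fun α => predictiveMean {0, 1} (armLikelihood P) α α fun a y =>
    tsallis (bayesUpdate (armLikelihood P a) α y)
  calc B.stepRegret t ^ 2 = (∫ ω, thompsonRegret ε (B.posterior t ω) ∂μ) ^ 2 := by
        rw [stepRegret_eq hε.1 hP hprior hTS]
    _ ≤ ∫ ω, thompsonRegret ε (B.posterior t ω) ^ 2 ∂μ :=
        even_two.convexOn_pow.map_integral_le (continuous_pow 2).continuousOn isClosed_univ
          (.of_forall fun _ => Set.mem_univ _) (hint (thompsonRegret ε))
          (hint fun α => thompsonRegret ε α ^ 2)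
    _ ≤ ∫ ω, √K * (tsallis (B.posterior t ω) -
          predictiveMean {0, 1} (armLikelihood P) (B.posterior t ω) (B.posterior t ω) fun a y =>
            tsallis (bayesUpdate (armLikelihood P a) (B.posterior t ω) y)) ∂μ := by
        refine integral_mono_ae (hint fun α => thompsonRegret ε α ^ 2)
          (((hint tsallis).sub hint').const_mul _) ?_
        filter_upwards [ae_posterior_pos_and_sum hp hε hP hprior t] with ω ⟨hpos, hsum⟩
        exact sq_thompsonRegret_le hP hp hε hpos hsum
    _ = √K * (∫ ω, tsallis (B.posterior t ω) ∂μ - ∫ ω, tsallis (B.posterior (t + 1) ω) ∂μ) := by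
        rw [integral_const_mul, integral_sub (hint tsallis) hint',
          integral_comp_posterior_succ hε.1 hP hprior hTS]

lemma sum_sq_stepRegret_le (T : ℕ) : ∑ t ∈ Finset.range T, B.stepRegret t ^ 2 ≤ 2 * K := by
  have hinit : ∫ ω, tsallis (B.posterior 0 ω) ∂μ ≤ 2 * √K := by
    refine (integral_mono_ae (integrable_comp_posterior hε.1 hP hprior tsallis 0)
      (integrable_const (2 * √K)) ?_).trans_eq (by simp)
    filter_upwards [ae_posterior_pos_and_sum hp hε hP hprior 0] with ω ⟨hpos, hsum⟩
    simpa using tsallis_le (fun i => (hpos i).le) hsum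
  have hfinal : 0 ≤ ∫ ω, tsallis (B.posterior T ω) ∂μ := integral_nonneg fun _ => tsallis_nonneg _
  calc ∑ t ∈ Finset.range T, B.stepRegret t ^ 2
      ≤ ∑ t ∈ Finset.range T, √K *
          (∫ ω, tsallis (B.posterior t ω) ∂μ - ∫ ω, tsallis (B.posterior (t + 1) ω) ∂μ) :=
        Finset.sum_le_sum fun t _ => sq_stepRegret_le hp hε hP hprior hTS t
    _ = √K * (∫ ω, tsallis (B.posterior 0 ω) ∂μ - ∫ ω, tsallis (B.posterior T ω) ∂μ) := by
        rw [← Finset.mul_sum, Finset.sum_range_sub']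
    _ ≤ √K * (2 * √K) := by
        gcongr
        linarith
    _ = 2 * K := by rw [mul_left_comm, Real.mul_self_sqrt (Nat.cast_nonneg K)]

lemma regret_le_sqrt (T : ℕ) : B.regret T ≤ √(2 * K * T) := by
  refine Real.le_sqrt_of_sq_le ?_
  calc B.regret T ^ 2 = (∑ t ∈ Finset.range T, B.stepRegret t) ^ 2 := by
        rw [regret_eq_sum_stepRegret hε.1 hP hprior]
    _ ≤ T * ∑ t ∈ Finset.range T, B.stepRegret t ^ 2 := by
        simpa using sq_sum_le_card_mul_sum_sq (s := Finset.range T) (f := B.stepRegret)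
    _ ≤ T * (2 * K) := by
        gcongr
        exact sum_sq_stepRegret_le hp hε hP hprior hTS T
    _ = 2 * K * T := mul_comm _ _

lemma two_mul_stepRegret_le {t : ℕ} (ht : 1 ≤ t) : 2 * B.stepRegret t ≤ √(8 * K / t) := by
  have ht0 : (0 : ℝ) < t := by exact_mod_cast ht
  have hsum : t * B.stepRegret t ≤ √(2 * K * t) :=
    calc t * B.stepRegret t = (Finset.range t).card • B.stepRegret t := by
          rw [Finset.card_range, nsmul_eq_mul]
      _ ≤ ∑ s ∈ Finset.range t, B.stepRegret s :=
          Finset.card_nsmul_le_sum _ _ _ fun s hs =>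
            stepRegret_antitone hp hε hP hprior hTS (Finset.mem_range.1 hs).le
      _ = B.regret t := (regret_eq_sum_stepRegret hε.1 hP hprior t).symm
      _ ≤ √(2 * K * t) := regret_le_sqrt hp hε hP hprior hTS t
  calc 2 * B.stepRegret t ≤ 2 / t * √(2 * K * t) := by
        rw [div_mul_eq_mul_div, le_div_iff₀' ht0]
        linarith
    _ = √(8 * K / t) := by
        rw [← Real.sqrt_sq (div_pos zero_lt_two ht0).le, ← Real.sqrt_mul (sq_nonneg _)]
        congr 1
        field_simp
        ring

lemma one_sub_le_real_half_lt_maxPosterior {t : ℕ} (ht : 1 ≤ t) :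
    1 - 1 / ε * √(8 * K / t) ≤ μ.real {ω | 1 / 2 < B.maxPosterior t ω} := by
  have hε0 := hε.1
  have hae := ae_posterior_pos_and_sum hp hε hP hprior t
  have hcompl : μ.real {ω | 1 / 2 < B.maxPosterior t ω}ᶜ ≤
      μ.real {ω | ε / 2 ≤ thompsonRegret ε (B.posterior t ω)} := by
    refine ENNReal.toReal_mono (measure_ne_top _ _) (measure_mono_ae ?_)
    filter_upwards [hae] with ω ⟨hpos, hsum⟩ hω
    exact half_le_thompsonRegret hε0.le (fun i => (hpos i).le) hsum (not_lt.1 hω)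
  have hmarkov : ε / 2 * μ.real {ω | ε / 2 ≤ thompsonRegret ε (B.posterior t ω)} ≤
      B.stepRegret t := by
    rw [stepRegret_eq hε0 hP hprior hTS]
    exact mul_meas_ge_le_integral_of_nonneg
      (hae.mono fun ω hω => thompsonRegret_nonneg hε0.le (fun i => (hω.1 i).le) hω.2)
      (integrable_comp_posterior hε0 hP hprior _ t) _
  have hunion : 1 ≤ μ.real {ω | 1 / 2 < B.maxPosterior t ω} +
      μ.real {ω | 1 / 2 < B.maxPosterior t ω}ᶜ := by
    simpa using measureReal_union_le (μ := μ) {ω | 1 / 2 < B.maxPosterior t ω}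
      {ω | 1 / 2 < B.maxPosterior t ω}ᶜ
  have hrare : μ.real {ω | ε / 2 ≤ thompsonRegret ε (B.posterior t ω)} ≤
      1 / ε * √(8 * K / t) := by
    rw [one_div, ← div_eq_inv_mul, le_div_iff₀' hε0]
    linarith [two_mul_stepRegret_le hp hε hP hprior hTS ht]
  linarith

end HardMarginals

end BayesianBandit

end

theorem proposition2 {Ω : Type*} [MeasurableSpace Ω] (μ : Measure Ω) [IsProbabilityMeasure μ]
    {K : ℕ} (hK : 2 ≤ K) {p ε : ℝ} (hp : p ∈ Set.Ioo (0 : ℝ) 1) (hε : ε ∈ Set.Ioo 0 (1 - p))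
    (P : Fin K → RewardLaw K) (hP : HasHardMarginals p ε P)
    (B : BayesianBandit K μ) (hprior : μ.map B.pStar = uniformPrior P)
    (hTS : B.IsThompsonSampling) :
    (∀ t : ℕ, 1 ≤ t →
      1 - 1 / ε * Real.sqrt (8 * K / t) ≤ μ.real {ω | 1 / 2 < B.maxPosterior t ω}) ∧
    (∀ t : ℕ, ∀ᵐ ω ∂μ, 0 < B.policyInfoGain negentropy t ω ∧
      B.infoRatio negentropy t ω ≤
        (1 + B.maxPosterior t ω) ^ 2 / (2 * B.maxPosterior t ω ^ 2)) ∧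
    (∀ t : ℕ, 1 ≤ t →
      1 - 1 / ε * Real.sqrt (8 * K / t) ≤ μ.real {ω | B.infoRatio negentropy t ω ≤ 8}) ∧
    (∀ T : ℕ, B.regret T ≤ 6 * Real.sqrt (2 * K * T)) := by
  have : Nontrivial (Fin K) := Fin.nontrivial_iff_two_le.2 hK
  have hmax := fun (t : ℕ) (ht : 1 ≤ t) =>
    BayesianBandit.one_sub_le_real_half_lt_maxPosterior hp hε hP hprior hTS ht
  have hratio := fun t => BayesianBandit.infoRatio_le hp hε hP hprior hTS t
  refine ⟨hmax, hratio, fun t ht => ?_, fun T => ?_⟩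
  · refine (hmax t ht).trans (ENNReal.toReal_mono (measure_ne_top _ _) (measure_mono_ae ?_))
    filter_upwards [hratio t] with ω hω (hq : 1 / 2 < B.maxPosterior t ω)
    refine hω.2.trans ?_
    rw [div_le_iff₀ (by positivity)]
    nlinarith
  · linarith [BayesianBandit.regret_le_sqrt hp hε hP hprior hTS T, Real.sqrt_nonneg (2 * K * T : ℝ)]
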